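/- Let $E=(E^0,E^1,r,s)$ be a finite directed graph in which every vertex receives at least one edge and emits at least one edge. Let $E^\infty$ be the compact space of right-infinite paths $c=c_0c_1c_2\cdots$ (edges with $s(c_i)=r(c_{i+1})$), put $r(c)=r(c_0)$, let $\sigma(c_0c_1c_2\cdots)=c_1c_2\cdots$ be the shift on $E^\infty$, let $E^{(-\infty,\infty)}$ be the compact space of two-sided infinite paths, $E^{[-k,\infty)}$ the space of paths $c_{-k}c_{-k+1}\cdots$, and $\pi_k:E^{(-\infty,\infty)}\to E^{[-k,\infty)}$ the projections. Put $A=C(E^\infty)$, $\alpha(f)=f\circ\sigma$, and $$L(f)(c)=\frac1{|s^{-1}(r(c))|}\sum_{s(e)=r(c)}f(ec).$$ Let $M_L$ be Exel's correspondence over $A$: the completion of $A$ with right action $x\cdot f=x\alpha(f)$, inner product $\langle x,y\rangle=L(x^*y)$, and left action by multiplication. Let $\{w(e):e\in E^1\}$ be non-zero complex numbers with $\sum_{s(e)=v}|w(e)|^2=|s^{-1}(v)|$ for every $v\in E^0$, and let $m=\sum_{e\in E^1}w(e)\chi_{Z(e)}\in C(E^\infty)$, where $Z(e)=\{c:c_0=e\}$.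 For $c\in E^\infty$ there is a probability measure $\mu^c$ on $E^{(-\infty,\infty)}$, carried by $\pi_0^{-1}(c)$, such that for all $k\ge 0$ and $x\in C(E^{[-k,\infty)})$ $$\int x\circ\pi_k\,d\mu^c=\sum_{d}x(d)|w_k(d)|^2,\qquad |w_k(d)|^2=\prod_{j=-k}^{-1}|w(d_j)|^2\,|s^{-1}(s(d_j))|^{-1},$$ where $d$ runs over the elements of $E^{[-k,\infty)}$ with $d_0d_1\cdots=c$. Let $X_\infty(E)$ be the Hilbert $A$-module obtained by completing $C(E^{(-\infty,\infty)})$ with $(x\cdot f)(d)=x(d)f(\pi_0(d))$ and $\langle x,y\rangle(c)=\int\overline{x}\,y\,d\mu^c$. Let $h$ be the backward shift on $E^{(-\infty,\infty)}$, $h(c)_i=c_{i+1}$, and $(Dx)(c)=m(\pi_0(c))\,x(h(c))$ for $x\in C(E^{(-\infty,\infty)})$. Then: 1. $m$ is a filter in $M_L$, that is, $\langle m,m\rangle=1$. 2. $D$ extends to a bounded linear isomorphism $D$ (with bounded inverse) of $X_\infty(E)$ onto itself, and $(X_\infty(E),D,1)$ is a scaling function for $m$. That is, under the identification of $X_\infty(E)$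 with $X_\infty(E)\otimes_AM_L$ by $y\mapsto y\otimes 1$, the map $D$ becomes a Hilbert-module isomorphism $D':x\mapsto (Dx)\otimes 1$ of $X_\infty(E)$ onto the internal tensor product $X_\infty(E)\otimes_A M_L$; moreover $\langle 1,1\rangle=1$ and $D'1=1\otimes m$. 3. Let $(M_\infty,\iota^k)$ be the direct limit of the Hilbert modules $M_L^{\otimes k}$ (internal tensor powers over $A$, with $M_L^{\otimes 0}=A$) under the inner-product preserving maps $T_k:M_L^{\otimes k}\to M_L^{\otimes(k+1)}$, $T_k n=m\otimes n$. There is a Hilbert-module isomorphism $Q$ of $M_\infty$ onto $X_\infty(E)$ such that the submodules $V_k=Q(\iota^k(M_L^{\otimes k}))$, $k\ge 0$, form a projective multi-resolution analysis for $X_\infty(E)$: (i) $V_0$ is a complemented $A$-submodule of $X_\infty(E)$; (ii) $V_k=D^{-k}(V_0)$ for $k\ge0$; (iii) $V_k$ is a complemented submodule of $V_{k+1}$ for $k\ge0$; (iv) $\bigcup_{k\ge0}V_k$ is dense in $X_\infty(E)$. (A closed submodule $V$ of $W$ is complemented if every element of $W$ is the sum of an element of $V$ and an element of $W$ orthogonal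 to $V$.) -/

import Mathlib

open scoped ComplexOrder TensorProduct
open UniformSpace

universe u

noncomputable section

lemma ContinuousMap.isClosed_nonneg_complex (K : Type u) [TopologicalSpace K] :
    IsClosed {f : C(K, ℂ) | 0 ≤ f} := by
  have : {f : C(K, ℂ) | 0 ≤ f} = ⋂ c : K, {f : C(K, ℂ) | 0 ≤ f c} := by
    ext f; simp [ContinuousMap.le_def]
  rw [this]
  refine isClosed_iInter fun c => ?_
  exact isClosed_le continuous_const (continuous_eval_const c)

/-- A right Hilbert module over the commutative C⋆-algebra `C(K, ℂ)`. As the coefficient algebra is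
commutative, the right action `x · f` is written `f • x`. The inner product is `ℂ`-linear and
`C(K, ℂ)`-linear in the second variable. -/
structure HilbMod (K : Type u) [TopologicalSpace K] [CompactSpace K] where
  carrier : Type u
  [normedAddCommGroup : NormedAddCommGroup carrier]
  [normedSpace : NormedSpace ℂ carrier]
  [module : Module C(K, ℂ) carrier]
  [isScalarTower : IsScalarTower ℂ C(K, ℂ) carrier]
  [cstarModule : CStarModule C(K, ℂ) carrier]
  [completeSpace : CompleteSpace carrier]

/-- A `C(K, ℂ)`-module with a positive semidefinite `C(K, ℂ)`-valued inner product. -/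
structure PreHilbMod (K : Type u) [TopologicalSpace K] [CompactSpace K] where
  carrier : Type u
  [addCommGroup : AddCommGroup carrier]
  [moduleC : Module ℂ carrier]
  [module : Module C(K, ℂ) carrier]
  [isScalarTower : IsScalarTower ℂ C(K, ℂ) carrier]
  form : carrier → carrier → C(K, ℂ)
  form_add : ∀ x y z, form x (y + z) = form x y + form x z
  form_smul : ∀ (f : C(K, ℂ)) x y, form x (f • y) = f * form x y
  star_form : ∀ x y, star (form x y) = form y x
  form_self_nonneg : ∀ x, 0 ≤ form x x

section Modules

variable {K : Type u} [TopologicalSpace K] [CompactSpace K]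

instance : CoeSort (HilbMod K) (Type u) := ⟨HilbMod.carrier⟩

attribute [instance] HilbMod.normedAddCommGroup HilbMod.normedSpace HilbMod.module
  HilbMod.isScalarTower HilbMod.cstarModule HilbMod.completeSpace

attribute [instance] PreHilbMod.addCommGroup PreHilbMod.moduleC PreHilbMod.module
  PreHilbMod.isScalarTower

namespace PreHilbMod

variable (P : PreHilbMod K)

lemma form_smulC (z : ℂ) (x y : P.carrier) : P.form x (z • y) = z • P.form x y := by
  have h : z • y = (z • (1 : C(K, ℂ))) • y := by rw [smul_assoc, one_smul]
  rw [h, P.form_smul, smul_mul_assoc, one_mul]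

lemma add_form (x y z : P.carrier) : P.form (x + y) z = P.form x z + P.form y z := by
  rw [← P.star_form z (x + y), P.form_add, star_add, P.star_form, P.star_form]

lemma smul_form (f : C(K, ℂ)) (x y : P.carrier) : P.form (f • x) y = star f * P.form x y := by
  rw [← P.star_form y (f • x), P.form_smul, star_mul, P.star_form, mul_comm]

lemma smulC_form (z : ℂ) (x y : P.carrier) : P.form (z • x) y = star z • P.form x y := by
  rw [← P.star_form y (z • x), P.form_smulC, star_smul, P.star_form]

/-- Evaluation of the inner product at a point, as a scalar semi-inner product. -/
@[reducible] def coreAt (c : K) : PreInnerProductSpace.Core ℂ P.carrier where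
  inner x y := P.form x y c
  conj_inner_symm x y := by
    have := congrArg (fun f : C(K, ℂ) => f c) (P.star_form y x)
    simpa using this
  re_inner_nonneg x := by
    have := P.form_self_nonneg x c
    exact (Complex.le_def.1 this).1
  add_left x y z := by simp [P.add_form]
  smul_left x y r := by simp [P.smulC_form]

lemma norm_form_apply_sq_le (x y : P.carrier) (c : K) :
    ‖P.form x y c‖ ^ 2 ≤ ‖P.form x x‖ * ‖P.form y y‖ := by
  let := P.coreAt c
  have h := InnerProductSpace.Core.inner_mul_inner_self_le (𝕜 := ℂ) (F := P.carrier) x y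
  have h1 : ‖P.form y x c‖ = ‖P.form x y c‖ := by
    rw [← P.star_form x y]; simp
  change ‖P.form x y c‖ * ‖P.form y x c‖ ≤ (P.form x x c).re * (P.form y y c).re at h
  rw [h1, ← sq] at h
  refine h.trans ?_
  have hx : (P.form x x c).re ≤ ‖P.form x x‖ :=
    (Complex.re_le_norm _).trans ((P.form x x).norm_coe_le_norm c)
  have hy : (P.form y y c).re ≤ ‖P.form y y‖ :=
    (Complex.re_le_norm _).trans ((P.form y y).norm_coe_le_norm c)
  exact mul_le_mul hx hy ((Complex.le_def.1 (P.form_self_nonneg y c)).1) (norm_nonneg _)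

/-- The seminorm `‖x‖ = ‖⟨x, x⟩‖ ^ (1/2)`. -/
instance : Norm P.carrier := ⟨fun x => √‖P.form x x‖⟩

lemma norm_def (x : P.carrier) : ‖x‖ = √‖P.form x x‖ := rfl

lemma norm_sq (x : P.carrier) : ‖x‖ ^ 2 = ‖P.form x x‖ := Real.sq_sqrt (norm_nonneg _)

lemma norm_form_le (x y : P.carrier) : ‖P.form x y‖ ≤ ‖x‖ * ‖y‖ := by
  refine (ContinuousMap.norm_le _ (mul_nonneg (Real.sqrt_nonneg _) (Real.sqrt_nonneg _))).2
    fun c => ?_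
  rw [← Real.sqrt_mul (norm_nonneg (P.form x x))]
  exact Real.le_sqrt_of_sq_le (P.norm_form_apply_sq_le x y c)

lemma seminormCore : SeminormedSpace.Core ℂ P.carrier where
  norm_nonneg _ := Real.sqrt_nonneg _
  norm_smul z x := by
    rw [P.norm_def, P.norm_def, P.form_smulC, P.smulC_form, smul_smul, norm_smul]
    rw [Real.sqrt_mul (norm_nonneg _)]
    congr 1
    rw [norm_mul, norm_star, Real.sqrt_mul_self (norm_nonneg _)]
  norm_triangle x y := by
    have h0 : 0 ≤ ‖x‖ := Real.sqrt_nonneg _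
    have h1 : 0 ≤ ‖y‖ := Real.sqrt_nonneg _
    refine le_of_sq_le_sq ?_ (add_nonneg h0 h1)
    rw [P.norm_sq, P.add_form, P.form_add, P.form_add]
    have hxy := P.norm_form_le x y
    have hyx := P.norm_form_le y x
    have hx := P.norm_sq x
    have hy := P.norm_sq y
    have := norm_add₃_le (a := P.form x x + P.form x y) (b := P.form y x) (c := P.form y y)
    have h3 := norm_add_le (P.form x x) (P.form x y)
    rw [← add_assoc]
    nlinarith

instance : SeminormedAddCommGroup P.carrier := SeminormedAddCommGroup.ofCore P.seminormCore

instance : NormedSpace ℂ P.carrier where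
  norm_smul_le z x := (P.seminormCore.norm_smul z x).le

instance : IsBoundedSMul C(K, ℂ) P.carrier := by
  refine IsBoundedSMul.of_norm_smul_le fun f x => ?_
  rw [P.norm_def, P.norm_def, P.form_smul, P.smul_form, ← mul_assoc]
  refine (Real.sqrt_le_sqrt ((norm_mul_le _ _).trans
    (mul_le_mul_of_nonneg_right (norm_mul_le _ _) (norm_nonneg _)))).trans ?_
  rw [norm_star, Real.sqrt_mul (by positivity), Real.sqrt_mul_self (norm_nonneg _)]

/-- The inner product as a continuous sesquilinear map. -/
def formL : P.carrier →L⋆[ℂ] P.carrier →L[ℂ] C(K, ℂ) :=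
  LinearMap.mkContinuous₂
    (LinearMap.mk₂'ₛₗ (starRingEnd ℂ) (RingHom.id ℂ) P.form (fun x y z => P.add_form x y z)
      (fun z x y => P.smulC_form z x y) (fun x y z => P.form_add x y z)
      (fun z x y => P.form_smulC z x y)) 1 (fun x y => by
        rw [one_mul]; exact P.norm_form_le x y)

lemma continuous_form : Continuous (Function.uncurry P.form) :=
  (show Continuous (Function.uncurry fun x y => P.formL x y) from
    (P.formL.continuous.comp continuous_fst).clm_apply continuous_snd)

instance : Inner C(K, ℂ) P.carrier := ⟨P.form⟩

lemma completion_inner_coe (x y : P.carrier) :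
    inner C(K, ℂ) (x : Completion P.carrier) (y : Completion P.carrier) = P.form x y :=
  (Completion.isDenseInducing_coe.prodMap Completion.isDenseInducing_coe).extend_eq
    P.continuous_form (x, y)

lemma completion_continuous_inner :
    Continuous (Function.uncurry (inner C(K, ℂ) (E := Completion P.carrier))) := by
  let inner' : P.carrier →+ P.carrier →+ C(K, ℂ) :=
    { toFun := fun x => (P.formL x).toLinearMap.toAddMonoidHom
      map_zero' := by ext; simp
      map_add' := fun x y => by ext; simp }
  have : Continuous fun p : P.carrier × P.carrier => inner' p.1 p.2 := P.continuous_form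
  rw [Completion.toInner, inner, Function.uncurry_curry _]
  exact (Completion.isDenseInducing_toCompl P.carrier).extend_Z_bilin
    (Completion.isDenseInducing_toCompl P.carrier) this

lemma completion_continuous_inner' {α : Type*} [TopologicalSpace α]
    {f g : α → Completion P.carrier} (hf : Continuous f) (hg : Continuous g) :
    Continuous fun x => inner C(K, ℂ) (f x) (g x) :=
  P.completion_continuous_inner.comp (hf.prodMk hg :)

lemma completion_norm_eq (x : Completion P.carrier) : ‖x‖ = √‖inner C(K, ℂ) x x‖ :=
  Completion.induction_on x
    (isClosed_eq continuous_norm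
      ((P.completion_continuous_inner' continuous_id continuous_id).norm.sqrt))
    fun a => by rw [Completion.norm_coe, P.completion_inner_coe, P.norm_def]

instance : CStarModule C(K, ℂ) (Completion P.carrier) where
  inner_add_right {x y z} := by
    refine Completion.induction_on₃ x y z (isClosed_eq ?_ ?_) fun a b c => ?_
    · exact P.completion_continuous_inner' (by fun_prop) (by fun_prop)
    · exact (P.completion_continuous_inner' (by fun_prop) (by fun_prop)).add
        (P.completion_continuous_inner' (by fun_prop) (by fun_prop))
    · simp only [← Completion.coe_add, P.completion_inner_coe, P.form_add]
  inner_self_nonneg {x} := by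
    refine Completion.induction_on x ((ContinuousMap.isClosed_nonneg_complex K).preimage
      (P.completion_continuous_inner' continuous_id continuous_id)) fun a => ?_
    simpa only [id, P.completion_inner_coe] using P.form_self_nonneg a
  inner_self {x} := by
    rw [← norm_eq_zero (a := x), P.completion_norm_eq, Real.sqrt_eq_zero (norm_nonneg _),
      norm_eq_zero]
  inner_op_smul_right {f x y} := by
    refine Completion.induction_on₂ x y (isClosed_eq ?_ ?_) fun a b => ?_
    · exact P.completion_continuous_inner' continuous_fst (continuous_snd.const_smul f)
    · exact continuous_const.mul (P.completion_continuous_inner' continuous_fst continuous_snd)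
    · simp only [← Completion.coe_smul, P.completion_inner_coe, P.form_smul]
  inner_smul_right_complex {z x y} := by
    refine Completion.induction_on₂ x y (isClosed_eq ?_ ?_) fun a b => ?_
    · exact P.completion_continuous_inner' continuous_fst (continuous_snd.const_smul z)
    · exact (P.completion_continuous_inner' continuous_fst continuous_snd).const_smul z
    · simp only [← Completion.coe_smul, P.completion_inner_coe, P.form_smulC]
  star_inner x y := by
    refine Completion.induction_on₂ x y (isClosed_eq ?_ ?_) fun a b => ?_
    · exact (P.completion_continuous_inner' continuous_fst continuous_snd).star
    · exact P.completion_continuous_inner' continuous_snd continuous_fst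
    · simp only [P.completion_inner_coe, P.star_form]
  norm_eq_sqrt_norm_inner_self x := P.completion_norm_eq x

/-- The Hilbert module obtained by dividing out the vectors of length zero and completing. -/
def completion : HilbMod K where
  carrier := Completion P.carrier

/-- The canonical map of a semi-inner-product module into its completion. -/
def toCompletion : P.carrier →ₗ[C(K, ℂ)] P.completion where
  toFun x := (x : Completion P.carrier)
  map_add' x y := Completion.coe_add x y
  map_smul' f x := Completion.coe_smul f x

end PreHilbMod


/-- A correspondence over `C(K, ℂ)`: a Hilbert module together with a left action by adjointable
operators, given by a unital `*`-homomorphism (so that it is essential as a left module). -/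
structure Corr (K : Type u) [TopologicalSpace K] [CompactSpace K] extends HilbMod K where
  left : C(K, ℂ) →ₐ[ℂ] Module.End C(K, ℂ) carrier
  inner_left : ∀ (f : C(K, ℂ)) (x y : carrier),
    inner C(K, ℂ) (left f x) y = inner C(K, ℂ) x (left (star f) y)

/-- A semi-inner-product module with a left action, to be completed to a correspondence. -/
structure PreCorr (K : Type u) [TopologicalSpace K] [CompactSpace K] extends PreHilbMod K where
  left : C(K, ℂ) →ₐ[ℂ] Module.End C(K, ℂ) carrier
  form_left : ∀ (f : C(K, ℂ)) (x y : carrier), form (left f x) y = form x (left (star f) y)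

lemma exists_complement_square (f : C(K, ℂ)) :
    ∃ g : C(K, ℂ), star g * g = ((‖f‖ ^ 2 : ℝ) : ℂ) • (1 : C(K, ℂ)) - star f * f := by
  refine ⟨⟨fun c => ((√(‖f‖ ^ 2 - ‖f c‖ ^ 2) : ℝ) : ℂ), by fun_prop⟩, ?_⟩
  ext c
  have h : 0 ≤ ‖f‖ ^ 2 - ‖f c‖ ^ 2 := by
    have := f.norm_coe_le_norm c
    have := norm_nonneg (f c)
    nlinarith
  simp only [ContinuousMap.coe_mul, ContinuousMap.coe_star, Pi.mul_apply, Pi.star_apply,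
    ContinuousMap.coe_mk, ContinuousMap.coe_sub, ContinuousMap.coe_smul, Pi.sub_apply,
    Pi.smul_apply, ContinuousMap.coe_one, Pi.one_apply, RCLike.star_def, Complex.conj_ofReal,
    Complex.conj_mul', smul_eq_mul, mul_one]
  rw [← Complex.ofReal_mul, Real.mul_self_sqrt h]
  push_cast
  ring

namespace PreCorr

variable (P : PreCorr K)

lemma norm_left_le (f : C(K, ℂ)) (x : P.carrier) : ‖P.left f x‖ ≤ ‖f‖ * ‖x‖ := by
  obtain ⟨g, hg⟩ := exists_complement_square f
  have h1 : P.form (P.left g x) (P.left g x) =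
      ((‖f‖ ^ 2 : ℝ) : ℂ) • P.form x x - P.form (P.left f x) (P.left f x) := by
    rw [P.form_left, P.form_left, ← Module.End.mul_apply, ← Module.End.mul_apply, ← map_mul,
      ← map_mul, hg, map_sub, map_smul, map_one, LinearMap.sub_apply, LinearMap.smul_apply,
      Module.End.one_apply, sub_eq_add_neg, P.form_add, P.form_smulC, ← neg_one_smul ℂ,
      P.form_smulC, neg_one_smul, ← sub_eq_add_neg]
  have h2 := P.form_self_nonneg (P.left g x)
  rw [h1, sub_nonneg] at h2
  have h3 : ‖P.form (P.left f x) (P.left f x)‖ ≤ ‖((‖f‖ ^ 2 : ℝ) : ℂ) • P.form x x‖ :=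
    CStarAlgebra.norm_le_norm_of_nonneg_of_le (P.form_self_nonneg _) h2
  rw [norm_smul, Complex.norm_real, Real.norm_of_nonneg (by positivity), ← P.norm_sq,
    ← P.norm_sq, ← mul_pow] at h3
  exact le_of_sq_le_sq h3 (by positivity)

lemma uniformContinuous_left (f : C(K, ℂ)) : UniformContinuous (P.left f) :=
  ((P.left f).toAddMonoidHom.mkNormedAddGroupHom ‖f‖ (P.norm_left_le f)).uniformContinuous

/-- The extension of the left action to the completion. -/
def leftCompletion (f : C(K, ℂ)) : Module.End C(K, ℂ) (Completion P.carrier) where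
  toFun := Completion.map (P.left f)
  map_add' x y := by
    have hc : Continuous (Completion.map (P.left f)) := Completion.continuous_map
    refine Completion.induction_on₂ x y (isClosed_eq ?_ ?_) fun a b => ?_
    · exact hc.comp continuous_add
    · exact (hc.comp continuous_fst).add (hc.comp continuous_snd)
    · rw [← Completion.coe_add, Completion.map_coe (P.uniformContinuous_left f),
        Completion.map_coe (P.uniformContinuous_left f),
        Completion.map_coe (P.uniformContinuous_left f), ← Completion.coe_add, map_add]
  map_smul' g x := by
    have hc : Continuous (Completion.map (P.left f)) := Completion.continuous_map
    refine Completion.induction_on x (isClosed_eq ?_ ?_) fun a => ?_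
    · exact hc.comp (continuous_const_smul g)
    · exact (continuous_const_smul g).comp hc
    · rw [← Completion.coe_smul, Completion.map_coe (P.uniformContinuous_left f),
        Completion.map_coe (P.uniformContinuous_left f), ← Completion.coe_smul, map_smul, RingHom.id_apply]

lemma leftCompletion_coe (f : C(K, ℂ)) (x : P.carrier) :
    P.leftCompletion f (x : Completion P.carrier) = (P.left f x : P.carrier) :=
  Completion.map_coe (P.uniformContinuous_left f) x

lemma continuous_leftCompletion (f : C(K, ℂ)) : Continuous (P.leftCompletion f) :=
  Completion.continuous_map

lemma end_ext {S T : Module.End C(K, ℂ) (Completion P.carrier)} (hS : Continuous S)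
    (hT : Continuous T) (h : ∀ x : P.carrier, S (x : Completion P.carrier) = T x) :
    S = T := by
  ext x
  exact Completion.induction_on x (isClosed_eq hS hT) h

/-- The extension of the left action to the completion, as a homomorphism. -/
def leftCompletionHom : C(K, ℂ) →ₐ[ℂ] Module.End C(K, ℂ) (Completion P.carrier) :=
  AlgHom.ofLinearMap
    { toFun := P.leftCompletion
      map_add' := fun f g => P.end_ext (P.continuous_leftCompletion _)
        ((P.continuous_leftCompletion f).add (P.continuous_leftCompletion g)) fun x => by
          rw [LinearMap.add_apply]
          simp only [P.leftCompletion_coe, map_add, LinearMap.add_apply, Completion.coe_add]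
      map_smul' := fun z f => P.end_ext (P.continuous_leftCompletion _)
        ((P.continuous_leftCompletion f).const_smul z) fun x => by
          rw [RingHom.id_apply, LinearMap.smul_apply]
          simp only [P.leftCompletion_coe, map_smul, LinearMap.smul_apply, Completion.coe_smul] }
    (P.end_ext (P.continuous_leftCompletion _) continuous_id fun x => by
      simp [P.leftCompletion_coe])
    (fun f g => P.end_ext (P.continuous_leftCompletion _)
      ((P.continuous_leftCompletion f).comp (P.continuous_leftCompletion g)) fun x => by
        simp [P.leftCompletion_coe])

lemma inner_leftCompletion (f : C(K, ℂ)) (x y : Completion P.carrier) :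
    inner C(K, ℂ) (P.leftCompletion f x) y = inner C(K, ℂ) x (P.leftCompletion (star f) y) := by
  refine Completion.induction_on₂ x y (isClosed_eq ?_ ?_) fun a b => ?_
  · exact P.completion_continuous_inner' ((P.continuous_leftCompletion f).comp continuous_fst)
      continuous_snd
  · exact P.completion_continuous_inner' continuous_fst
      ((P.continuous_leftCompletion (star f)).comp continuous_snd)
  · rw [P.leftCompletion_coe, P.leftCompletion_coe, P.completion_inner_coe,
      P.completion_inner_coe, P.form_left]

/-- The correspondence obtained by dividing out the vectors of length zero and completing. -/
def completion : Corr K where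
  toHilbMod := P.toPreHilbMod.completion
  left := P.leftCompletionHom
  inner_left f x y := P.inner_leftCompletion f x y

end PreCorr

lemma exists_sqrt_negPart {B : Type u} [CStarAlgebra B] (G : B) (hG : IsSelfAdjoint G) :
    ∃ N R : B, star N = N ∧ star R = R ∧ R * R = N ∧ N * G * N = -(N * N * N) ∧
      (N = 0 → ∃ S : B, star S * S = G) := by
  let := CStarAlgebra.spectralOrder B
  have := CStarAlgebra.spectralOrderedRing B
  have hN0 : 0 ≤ G⁻ := CFC.negPart_nonneg G
  refine ⟨G⁻, CFC.sqrt G⁻, (IsSelfAdjoint.of_nonneg hN0).star_eq,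
    (IsSelfAdjoint.of_nonneg (CFC.sqrt_nonneg _)).star_eq, CFC.sqrt_mul_sqrt_self _ hN0, ?_, ?_⟩
  · have h : G⁻ * G * G⁻ = G⁻ * (G⁺ - G⁻) * G⁻ := by rw [CFC.posPart_sub_negPart G]
    rw [h, mul_sub, CFC.negPart_mul_posPart, zero_sub, neg_mul]
  · intro h
    have h0 : 0 ≤ G := (CFC.negPart_eq_zero_iff G).1 h
    refine ⟨CFC.sqrt G, ?_⟩
    rw [(IsSelfAdjoint.of_nonneg (CFC.sqrt_nonneg G)).star_eq]
    exact CFC.sqrt_mul_sqrt_self G h0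

/-- The Gram matrix of finitely many vectors in a Hilbert module is of the form `H* H`. -/
lemma exists_gram_factor {ι : Type u} [Fintype ι] (X : HilbMod K) (x : ι → X) :
    ∃ H : ι → ι → C(K, ℂ), ∀ i j,
      inner C(K, ℂ) (x i) (x j) = ∑ p, star (H p i) * H p j := by
  classical
  set G : CStarMatrix ι ι C(K, ℂ) :=
    CStarMatrix.ofMatrix (Matrix.of fun i j => inner C(K, ℂ) (x i) (x j)) with hG
  have hGa : ∀ i j, G i j = inner C(K, ℂ) (x i) (x j) := fun i j => rfl
  have hsa : IsSelfAdjoint G := by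
    ext i j : 1
    rw [CStarMatrix.star_apply, hGa, hGa, CStarModule.star_inner]
  have hmul : ∀ (S T : CStarMatrix ι ι C(K, ℂ)) i j, (S * T) i j = ∑ k, S i k * T k j :=
    fun S T i j => CStarMatrix.mul_apply
  have hstar : ∀ (S : CStarMatrix ι ι C(K, ℂ)) i j, star S i j = star (S j i) :=
    fun S i j => CStarMatrix.star_apply
  obtain ⟨N, R, hNs, hRs, hRR, hNG, hfac⟩ := exists_sqrt_negPart G hsa
  have h3 : N * N * N = star (R * N) * (R * N) := by
    rw [star_mul, hNs, hRs, mul_assoc N R, ← mul_assoc R R N, hRR, mul_assoc]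
  have hdiag : ∀ i, 0 ≤ (N * G * N) i i := by
    intro i
    have : (N * G * N) i i = inner C(K, ℂ) (∑ j, N j i • x j) (∑ j, N j i • x j) := by
      simp only [hmul, CStarModule.inner_sum_left, CStarModule.inner_sum_right,
        CStarModule.inner_op_smul_left, CStarModule.inner_op_smul_right, Finset.sum_mul,
        Finset.mul_sum]
      refine Finset.sum_congr rfl fun k _ => Finset.sum_congr rfl fun j _ => ?_
      have : N i j = star (N j i) := by
        rw [← hstar, hNs]
      rw [hGa, this]
      ring
    rw [this]
    exact CStarModule.inner_self_nonneg
  have hzero : R * N = 0 := by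
    ext p i : 1
    have h1 := hdiag i
    have h2 : (star (R * N) * (R * N)) i i = ∑ q, star ((R * N) q i) * (R * N) q i := by
      rw [hmul]
      exact Finset.sum_congr rfl fun q _ => by rw [hstar]
    rw [hNG, h3, CStarMatrix.neg_apply, h2, neg_nonneg] at h1
    have h5 : ∑ q, star ((R * N) q i) * (R * N) q i = 0 :=
      le_antisymm h1 (Finset.sum_nonneg fun q _ => star_mul_self_nonneg _)
    have h6 := (Finset.sum_eq_zero_iff_of_nonneg fun q _ => star_mul_self_nonneg _).1 h5 p
      (Finset.mem_univ _)
    rw [CStarMatrix.zero_apply]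
    exact (CStarRing.star_mul_self_eq_zero_iff _).1 h6
  have hN : N = 0 := by
    have : star N * N = 0 := by rw [hNs, ← hRR, mul_assoc, hRR, hzero, mul_zero]
    exact (CStarRing.star_mul_self_eq_zero_iff _).1 this
  obtain ⟨S, hS⟩ := hfac hN
  refine ⟨fun i j => S i j, fun i j => ?_⟩
  rw [← hGa, ← hS, hmul]
  exact Finset.sum_congr rfl fun q _ => by rw [hstar]

namespace HilbMod

variable (X : HilbMod K) (M : Corr K)

/-- The sesquilinear form `⟨x ⊗ m, y ⊗ n⟩ = ⟨m, ⟨x, y⟩ · n⟩` on the algebraic tensor product; the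
element `x ⊗ m` is represented by `m ⊗ₜ x`. -/
def tensorForm : M.carrier ⊗[ℂ] X.carrier →ₗ⋆[ℂ] M.carrier ⊗[ℂ] X.carrier →ₗ[ℂ] C(K, ℂ) :=
  TensorProduct.lift <| LinearMap.mk₂'ₛₗ (starRingEnd ℂ) (starRingEnd ℂ)
    (fun m x => TensorProduct.lift <| LinearMap.mk₂ ℂ
      (fun n y => inner C(K, ℂ) m (M.left (inner C(K, ℂ) x y) n))
      (fun n n' y => by simp)
      (fun z n y => by
        rw [LinearMap.map_smul_of_tower, CStarModule.inner_smul_right_complex])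
      (fun n y y' => by simp)
      (fun z n y => by simp))
    (fun m m' x => by ext n y; simp)
    (fun z m x => by ext n y; simp)
    (fun m x x' => by ext n y; simp)
    (fun z m x => by ext n y; simp)

@[simp] lemma tensorForm_tmul (m n : M.carrier) (x y : X) :
    X.tensorForm M (m ⊗ₜ x) (n ⊗ₜ y) = inner C(K, ℂ) m (M.left (inner C(K, ℂ) x y) n) := rfl

lemma star_tensorForm (s t : M.carrier ⊗[ℂ] X.carrier) :
    star (X.tensorForm M s t) = X.tensorForm M t s := by
  induction s with
  | zero => simp
  | add s s' hs hs' => simp [hs, hs']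
  | tmul m x =>
    induction t with
    | zero => simp
    | add t t' ht ht' => simp [ht, ht']
    | tmul n y =>
      rw [tensorForm_tmul, tensorForm_tmul, CStarModule.star_inner, M.inner_left,
        CStarModule.star_inner]

lemma tensorForm_self_nonneg (t : M.carrier ⊗[ℂ] X.carrier) : 0 ≤ X.tensorForm M t t := by
  obtain ⟨S, rfl⟩ := TensorProduct.exists_finset t
  obtain ⟨H, hH⟩ := exists_gram_factor X (fun i : S => i.1.2)
  have h : X.tensorForm M (∑ i ∈ S, i.1 ⊗ₜ[ℂ] i.2) (∑ i ∈ S, i.1 ⊗ₜ[ℂ] i.2) =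
      ∑ p : S, inner C(K, ℂ) (∑ i : S, M.left (H p i) i.1.1) (∑ i : S, M.left (H p i) i.1.1) := by
    rw [← Finset.sum_coe_sort S]
    simp only [map_sum, LinearMap.sum_apply, tensorForm_tmul, CStarModule.inner_sum_left,
      CStarModule.inner_sum_right, hH, M.inner_left]
    refine Eq.trans ?_ Finset.sum_comm
    refine Finset.sum_congr rfl fun i _ => ?_
    refine Eq.trans ?_ Finset.sum_comm
    refine Finset.sum_congr rfl fun j _ => ?_
    refine Finset.sum_congr rfl fun p _ => ?_
    rw [map_mul, Module.End.mul_apply]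
  rw [h]
  exact Finset.sum_nonneg fun p _ => CStarModule.inner_self_nonneg

/-- The algebraic tensor product with its semi-inner product and the right action
`(x ⊗ m) · f = x ⊗ (m · f)`. -/
def preTensor : PreHilbMod K where
  carrier := M.carrier ⊗[ℂ] X.carrier
  form s t := X.tensorForm M s t
  form_add s t t' := map_add _ _ _
  form_smul f s t := by
    induction t with
    | zero => simp
    | add t t' ht ht' => rw [smul_add, map_add, map_add, ht, ht', mul_add]
    | tmul n y =>
      induction s with
      | zero => simp
      | add s s' hs hs' => rw [map_add, LinearMap.add_apply, LinearMap.add_apply, hs, hs', mul_add]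
      | tmul m x =>
        rw [TensorProduct.smul_tmul', tensorForm_tmul, tensorForm_tmul, map_smul,
          CStarModule.inner_op_smul_right]
  star_form := X.star_tensorForm M
  form_self_nonneg := X.tensorForm_self_nonneg M

/-- The internal tensor product `X ⊗_A M` of a Hilbert module and a correspondence over
`A = C(K, ℂ)`. -/
def tensor : HilbMod K := (X.preTensor M).completion

/-- The elementary tensor `x ⊗ m` in `X ⊗_A M`. -/
def tmul (x : X) (m : M.carrier) : X.tensor M :=
  (X.preTensor M).toCompletion (show M.carrier ⊗[ℂ] X.carrier from m ⊗ₜ x)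

end HilbMod

namespace Corr

variable (M N : Corr K)

/-- The left action `f · (m ⊗ n) = (f · m) ⊗ n` on the algebraic tensor product. -/
def preTensorLeft : C(K, ℂ) →ₐ[ℂ] Module.End C(K, ℂ) (N.carrier ⊗[ℂ] M.carrier) :=
  AlgHom.ofLinearMap
    (TensorProduct.AlgebraTensorModule.lTensor C(K, ℂ) N.carrier ∘ₗ
      { toFun := fun f => (M.left f).restrictScalars ℂ
        map_add' := fun f g => by rw [map_add]; rfl
        map_smul' := fun z f => by rw [map_smul]; rfl })
    (by
      refine TensorProduct.AlgebraTensorModule.ext fun n m => ?_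
      simp)
    (fun f g => by
      refine TensorProduct.AlgebraTensorModule.ext fun n m => ?_
      simp)

@[simp] lemma preTensorLeft_tmul (f : C(K, ℂ)) (n : N.carrier) (m : M.carrier) :
    M.preTensorLeft N f (n ⊗ₜ m) = n ⊗ₜ (M.left f m) := rfl

lemma tensorForm_left (f : C(K, ℂ)) (s t : N.carrier ⊗[ℂ] M.carrier) :
    M.toHilbMod.tensorForm N (M.preTensorLeft N f s) t =
      M.toHilbMod.tensorForm N s (M.preTensorLeft N (star f) t) := by
  induction t with
  | zero => simp
  | add t t' ht ht' => rw [map_add, map_add, map_add, ht, ht']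
  | tmul n m =>
    induction s with
    | zero => simp
    | add s s' hs hs' => simp only [map_add, LinearMap.add_apply, hs, hs']
    | tmul n' m' =>
      simp only [preTensorLeft_tmul, HilbMod.tensorForm_tmul, M.inner_left]

/-- The algebraic tensor product of two correspondences. -/
def preTensor : PreCorr K where
  toPreHilbMod := M.toHilbMod.preTensor N
  left := M.preTensorLeft N
  form_left := M.tensorForm_left N

/-- The internal tensor product `M ⊗_A N` of two correspondences. Its underlying Hilbert module is
`M.toHilbMod.tensor N`. -/
def tensor : Corr K := (M.preTensor N).completion

/-- The correspondence `A_A` over `A = C(K, ℂ)`, with `⟨f, g⟩ = f* g`. -/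
def self (K : Type u) [TopologicalSpace K] [CompactSpace K] : Corr K where
  carrier := C(K, ℂ)
  left := (Algebra.lmul C(K, ℂ) C(K, ℂ)).restrictScalars ℂ
  inner_left f x y := by
    simp only [WithCStarModule.inner_def]
    simp
    ring

/-- The tensor powers `M^{⊗ k}`, with `M^{⊗ 0} = A_A` and `M^{⊗ (k + 1)} = M ⊗_A M^{⊗ k}`. -/
def pow : ℕ → Corr K
  | 0 => Corr.self K
  | k + 1 => M.tensor (pow k)

/-- A filter in `M`. -/
def IsFilter (m : M.carrier) : Prop := inner C(K, ℂ) m m = 1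

/-- The map `n ↦ m ⊗ n` from `N` to `M ⊗_A N`. -/
def tmulLeft (m : M.carrier) : N.carrier →ₗ[C(K, ℂ)] (M.toHilbMod.tensor N).carrier where
  toFun n := M.toHilbMod.tmul N m n
  map_add' n n' :=
    (congrArg (M.toHilbMod.preTensor N).toCompletion (TensorProduct.add_tmul n n' m)).trans
      (map_add (M.toHilbMod.preTensor N).toCompletion (n ⊗ₜ[ℂ] m) (n' ⊗ₜ[ℂ] m))
  map_smul' f n := map_smul (M.toHilbMod.preTensor N).toCompletion f (n ⊗ₜ[ℂ] m)

lemma inner_tmulLeft (m : M.carrier) (hm : M.IsFilter m) (n n' : N.carrier) :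
    inner C(K, ℂ) (M.tmulLeft N m n) (M.tmulLeft N m n') = inner C(K, ℂ) n n' := by
  refine (PreHilbMod.completion_inner_coe _ _ _).trans ?_
  change inner C(K, ℂ) n (N.left (inner C(K, ℂ) m m) n') = _
  rw [show inner C(K, ℂ) m m = 1 from hm, map_one, Module.End.one_apply]

end Corr

/-- A direct system of Hilbert modules `X 0 → X 1 → ⋯` with inner-product preserving maps. -/
structure HilbSystem (K : Type u) [TopologicalSpace K] [CompactSpace K] where
  X : ℕ → HilbMod K
  T : ∀ k, (X k).carrier →ₗ[C(K, ℂ)] (X (k + 1)).carrier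
  inner_T : ∀ k x y, inner C(K, ℂ) (T k x) (T k y) = inner C(K, ℂ) x y

namespace HilbSystem

variable (S : HilbSystem K)

/-- The composite `X i → X j` for `i ≤ j`. -/
def map (i j : ℕ) (h : i ≤ j) : (S.X i).carrier →ₗ[C(K, ℂ)] (S.X j).carrier :=
  Nat.leRec (motive := fun n _ => (S.X i).carrier →ₗ[C(K, ℂ)] (S.X n).carrier) LinearMap.id
    (fun n _ f => S.T n ∘ₗ f) h

lemma map_self (i : ℕ) (x : S.X i) : S.map i i le_rfl x = x := by
  rw [map, Nat.leRec_self]; rfl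

lemma map_succ (i j : ℕ) (h : i ≤ j) (x : S.X i) :
    S.map i (j + 1) (h.trans j.le_succ) x = S.T j (S.map i j h x) := by
  rw [map, Nat.leRec_succ _ _ h]; rfl

instance : DirectedSystem (fun k => (S.X k).carrier) (fun i j h => S.map i j h) where
  map_self i x := S.map_self i x
  map_map k j i hij hjk x := by
    induction k, hjk using Nat.le_induction with
    | base => rw [S.map_self]
    | succ n hn ih => rw [S.map_succ j n hn, S.map_succ i n (hij.trans hn), ih]

lemma inner_map (i j : ℕ) (h : i ≤ j) (x y : S.X i) :
    inner C(K, ℂ) (S.map i j h x) (S.map i j h y) = inner C(K, ℂ) x y := by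
  induction j, h using Nat.le_induction with
  | base => rw [S.map_self, S.map_self]
  | succ n hn ih => rw [S.map_succ i n hn, S.map_succ i n hn, S.inner_T, ih]

/-- The algebraic direct limit (the disjoint union of the `X k` modulo the identifications
`x ∼ T k x`) with its inner product. -/
def preLim : PreHilbMod K where
  carrier := DirectLimit (fun k => (S.X k).carrier) S.map
  moduleC := Module.compHom _ (algebraMap ℂ C(K, ℂ))
  isScalarTower := by
    let := Module.compHom (DirectLimit (fun k => (S.X k).carrier) S.map) (algebraMap ℂ C(K, ℂ))
    exact IsScalarTower.of_algebraMap_smul fun z x => rfl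
  form := DirectLimit.lift₂ S.map S.map (fun _ x y => inner C(K, ℂ) x y)
    (fun i j h x y => (S.inner_map i j h x y).symm)
  form_add := DirectLimit.induction₃ _ fun i x y z => by
    rw [DirectLimit.add_def]
    simp only [DirectLimit.lift₂_def, CStarModule.inner_add_right]
  form_smul f := DirectLimit.induction₂ _ fun i x y => by
    rw [DirectLimit.smul_def]
    simp only [DirectLimit.lift₂_def, CStarModule.inner_op_smul_right]
  star_form := DirectLimit.induction₂ _ fun i x y => by
    simp only [DirectLimit.lift₂_def, CStarModule.star_inner]
  form_self_nonneg := DirectLimit.induction _ fun i x => by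
    simp only [DirectLimit.lift₂_def]
    exact CStarModule.inner_self_nonneg

/-- The direct limit of the system: the completion of the algebraic direct limit. -/
def lim : HilbMod K := S.preLim.completion

/-- The canonical map `ι^k : X k → lim X`. -/
def ι (k : ℕ) : (S.X k).carrier →ₗ[C(K, ℂ)] S.lim.carrier :=
  S.preLim.toCompletion ∘ₗ DirectLimit.Module.of C(K, ℂ) ℕ (fun k => (S.X k).carrier) S.map k

end HilbSystem

/-- The direct system `(M^{⊗ k}, T_k)` with `T_k n = m ⊗ n` associated to a filter `m`. -/
def Corr.filterSystem (M : Corr K) (m : M.carrier) (hm : M.IsFilter m) : HilbSystem K where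
  X k := (M.pow k).toHilbMod
  T k := M.tmulLeft (M.pow k) m
  inner_T k := M.inner_tmulLeft (M.pow k) m hm

/-- An isomorphism of Hilbert modules: an inner-product preserving module isomorphism. -/
structure HilbMod.Iso (X Y : HilbMod K) extends X.carrier ≃ₗ[C(K, ℂ)] Y.carrier where
  inner_map : ∀ x y, inner C(K, ℂ) (toFun x) (toFun y) = inner C(K, ℂ) x y

/-- With `D : X → X ⊗_A M` an isomorphism, `(X, D, φ)` is a scaling function for `m ∈ M`. -/
def IsScalingFunction (M : Corr K) (m : M.carrier) (X : HilbMod K) (D : X.Iso (X.tensor M))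
    (φ : X) : Prop :=
  inner C(K, ℂ) φ φ = 1 ∧ D.toFun φ = X.tmul M φ m

/-- `V` is a closed submodule of `W` and `(m, n) ↦ m + n` maps `V ⊕ (W ∩ V^⊥)` onto `W`. -/
def HilbMod.IsComplementedIn (X : HilbMod K) (V W : Submodule C(K, ℂ) X.carrier) : Prop :=
  V ≤ W ∧ IsClosed (V : Set X.carrier) ∧
    ∀ x ∈ W, ∃ m ∈ V, ∃ n ∈ W, (∀ v ∈ V, inner C(K, ℂ) v n = 0) ∧ x = m + n

/-- A projective multi-resolution analysis for `X` with respect to a dilation `D : X → X`. -/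
structure IsProjectiveMRA (X : HilbMod K) (D : X.carrier → X.carrier)
    (V : ℕ → Submodule C(K, ℂ) X.carrier) : Prop where
  complemented_zero : X.IsComplementedIn (V 0) ⊤
  eq_preimage : ∀ k, (V k : Set X.carrier) = D^[k] ⁻¹' (V 0)
  complemented_succ : ∀ k, X.IsComplementedIn (V k) (V (k + 1))
  dense : Dense (⋃ k, (V k : Set X.carrier))

/-- An endomorphism `α` of `C(K, ℂ)` together with a transfer operator `L` for it. -/
structure TransferOperator (K : Type u) [TopologicalSpace K] [CompactSpace K] where
  α : C(K, ℂ) →⋆ₐ[ℂ] C(K, ℂ)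
  L : C(K, ℂ) →ₗ[ℂ] C(K, ℂ)
  nonneg : ∀ f, 0 ≤ f → 0 ≤ L f
  apply_mul : ∀ f g, L (f * α g) = L f * g

namespace TransferOperator

variable (τ : TransferOperator K)

lemma star_apply (f : C(K, ℂ)) : star (τ.L f) = τ.L (star f) := by
  obtain ⟨y, hy, -, hf⟩ := CStarAlgebra.exists_sum_four_nonneg f
  rw [hf]
  simp only [map_sum, map_smul, star_sum, star_smul, (IsSelfAdjoint.of_nonneg (hy _)).star_eq,
    (IsSelfAdjoint.of_nonneg (τ.nonneg _ (hy _))).star_eq]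

/-- The vector space `A_L = C(K, ℂ)` underlying Exel's correspondence. -/
def ExelSpace (_ : TransferOperator K) : Type u := C(K, ℂ)

instance : AddCommGroup τ.ExelSpace := inferInstanceAs (AddCommGroup C(K, ℂ))
instance : Module ℂ τ.ExelSpace := inferInstanceAs (Module ℂ C(K, ℂ))

/-- The right action `x · f = x α(f)`. -/
instance : Module C(K, ℂ) τ.ExelSpace :=
  Module.compHom C(K, ℂ) (τ.α : C(K, ℂ) →+* C(K, ℂ))

lemma exelSpace_smul_def (f : C(K, ℂ)) (x : τ.ExelSpace) :
    f • x = (show τ.ExelSpace from τ.α f * (show C(K, ℂ) from x)) := rfl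

instance : IsScalarTower ℂ C(K, ℂ) τ.ExelSpace where
  smul_assoc z f x := by
    change τ.α (z • f) * (show C(K, ℂ) from x) = z • (τ.α f * (show C(K, ℂ) from x))
    rw [map_smul, smul_mul_assoc]

/-- The left action of `C(K, ℂ)` on `A_L` by multiplication. -/
def exelLeft : C(K, ℂ) →ₐ[ℂ] Module.End C(K, ℂ) τ.ExelSpace where
  toFun f :=
    { toFun := fun x => (show τ.ExelSpace from f * (show C(K, ℂ) from x))
      map_add' := fun x y => mul_add (R := C(K, ℂ)) f x y
      map_smul' := fun g x => mul_left_comm (G := C(K, ℂ)) f (τ.α g) x }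
  map_one' := LinearMap.ext fun x => one_mul (M := C(K, ℂ)) x
  map_mul' f g := LinearMap.ext fun x => mul_assoc (G := C(K, ℂ)) f g x
  map_zero' := LinearMap.ext fun x => zero_mul (M₀ := C(K, ℂ)) x
  map_add' f g := LinearMap.ext fun x => add_mul (R := C(K, ℂ)) f g x
  commutes' z := LinearMap.ext fun x => by
    change algebraMap ℂ C(K, ℂ) z * (show C(K, ℂ) from x) = z • (show C(K, ℂ) from x)
    rw [Algebra.smul_def]

/-- `A_L` with the semi-inner product `⟨x, y⟩ = L(x* y)` and the left action by multiplication. -/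
def preExel : PreCorr K where
  carrier := τ.ExelSpace
  form (x y : C(K, ℂ)) := τ.L (star x * y)
  form_add (x y z : C(K, ℂ)) := by
    change τ.L (star x * (y + z)) = _
    rw [mul_add, map_add]
  form_smul f (x y : C(K, ℂ)) := by
    change τ.L (star x * (τ.α f * y)) = _
    rw [mul_comm (τ.α f), ← mul_assoc, τ.apply_mul, mul_comm]
  star_form (x y : C(K, ℂ)) := by rw [τ.star_apply, star_mul, star_star]
  form_self_nonneg (x : C(K, ℂ)) := τ.nonneg _ (star_mul_self_nonneg x)
  left := τ.exelLeft
  form_left f (x y : C(K, ℂ)) := by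
    change τ.L (star (f * x) * y) = τ.L (star x * (star f * y))
    rw [star_mul, mul_comm (star x), mul_assoc, mul_left_comm]

/-- Exel's correspondence `M_L`, the completion of `A_L`. -/
def exel : Corr K := τ.preExel.completion

/-- The image in `M_L` of an element of `A_L = C(K, ℂ)`. -/
def toExel (f : C(K, ℂ)) : τ.exel.carrier := τ.preExel.toPreHilbMod.toCompletion f

end TransferOperator

end Modules

/-! ### Directed graphs -/

/-- A finite directed graph. -/
structure FinDigraph where
  V : Type u
  E : Type u
  [fintypeV : Fintype V]
  [fintypeE : Fintype E]
  r : E → V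
  s : E → V

namespace FinDigraph

variable (G : FinDigraph.{u})

attribute [instance] FinDigraph.fintypeV FinDigraph.fintypeE

/-- Every vertex receives an edge. -/
def NoSources : Prop := ∀ v, ∃ e, G.r e = v

/-- Every vertex emits an edge. -/
def NoSinks : Prop := ∀ v, ∃ e, G.s e = v

instance : TopologicalSpace G.E := ⊥
instance : DiscreteTopology G.E := ⟨rfl⟩
instance : TopologicalSpace G.V := ⊥
instance : DiscreteTopology G.V := ⟨rfl⟩

/-- The set `s⁻¹(v)` of edges with source `v`. -/
def Out (v : G.V) : Type u := {e : G.E // G.s e = v}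

instance (v : G.V) : Fintype (G.Out v) :=
  letI := Classical.decEq G.V
  inferInstanceAs (Fintype {e : G.E // G.s e = v})
instance (v : G.V) : TopologicalSpace (G.Out v) := ⊥
instance (v : G.V) : DiscreteTopology (G.Out v) := ⟨rfl⟩
instance (v : G.V) : MeasurableSpace (G.Out v) := ⊤
instance (v : G.V) : DiscreteMeasurableSpace (G.Out v) := ⟨fun _ => trivial⟩

/-- The space `E^∞` of right-infinite paths `c₀c₁c₂⋯`, where `s(cᵢ) = r(cᵢ₊₁)`. -/
def InfPath : Type u := {c : ℕ → G.E // ∀ i, G.s (c i) = G.r (c (i + 1))}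

/-- The space `E^(-∞,∞)` of two-sided infinite paths `⋯c₋₁c₀c₁⋯`. -/
def BiPath : Type u := {c : ℤ → G.E // ∀ i, G.s (c i) = G.r (c (i + 1))}

instance : TopologicalSpace G.InfPath := instTopologicalSpaceSubtype
instance : TopologicalSpace G.BiPath := instTopologicalSpaceSubtype
instance : MeasurableSpace G.BiPath := borel _
instance : BorelSpace G.BiPath := ⟨rfl⟩
instance : FirstCountableTopology G.InfPath :=
  (Topology.IsInducing.subtypeVal (t := {c : ℕ → G.E |
    ∀ i, G.s (c i) = G.r (c (i + 1))})).firstCountableTopology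

lemma isClosed_path {I : Type} (next : I → I) :
    IsClosed {c : I → G.E | ∀ i, G.s (c i) = G.r (c (next i))} := by
  rw [Set.ofPred_forall]
  refine isClosed_iInter fun i => isClosed_eq ?_ ?_
  · exact (continuous_of_discreteTopology (f := G.s)).comp (continuous_apply i)
  · exact (continuous_of_discreteTopology (f := G.r)).comp (continuous_apply (next i))

instance : CompactSpace G.InfPath :=
  isCompact_iff_compactSpace.1 (G.isClosed_path (fun i : ℕ => i + 1)).isCompact

instance : CompactSpace G.BiPath :=
  isCompact_iff_compactSpace.1 (G.isClosed_path (fun i : ℤ => i + 1)).isCompact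

/-- The edge of index `i` of a path. -/
def edge (i : ℕ) : C(G.InfPath, G.E) :=
  ⟨fun c => c.1 i, (continuous_apply i).comp continuous_subtype_val⟩

lemma continuous_biEdge (i : ℤ) : Continuous fun d : G.BiPath => d.1 i :=
  (continuous_apply i).comp continuous_subtype_val

lemma continuous_edge (i : ℕ) : Continuous fun c : G.InfPath => c.1 i :=
  (continuous_apply i).comp continuous_subtype_val

/-- The range `r(c) = r(c₀)` of a right-infinite path. -/
def range (c : G.InfPath) : G.V := G.r (c.1 0)

/-- The backward shift `σ(c₀c₁c₂⋯) = c₁c₂⋯` on `E^∞`. -/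
def shift : C(G.InfPath, G.InfPath) where
  toFun c := ⟨fun i : ℕ => c.1 (i + 1), fun i => c.2 (i + 1)⟩
  continuous_toFun := Continuous.subtype_mk
    (continuous_pi fun i : ℕ => G.continuous_edge (i + 1)) _

/-- The path `ec`, for an edge `e` with `s(e) = r(c)`. -/
def cons (e : G.E) (c : G.InfPath) (h : G.s e = G.range c) : G.InfPath :=
  ⟨fun i => Nat.casesOn i e c.1, fun i => by
    cases i with
    | zero => exact h
    | succ n => exact c.2 n⟩

/-- The transfer operator `L(f)(c) = |s⁻¹(r(c))|⁻¹ ∑_{s(e) = r(c)} f(ec)`, as a function. -/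
def transferFun (f : C(G.InfPath, ℂ)) (c : G.InfPath) : ℂ :=
  (Fintype.card (G.Out (G.range c)) : ℂ)⁻¹ *
    ∑ e : G.Out (G.range c), f (G.cons e.1 c e.2)

lemma continuous_range : Continuous G.range :=
  (continuous_of_discreteTopology (f := G.r)).comp
    ((continuous_apply 0).comp continuous_subtype_val)

open Classical in
lemma continuous_transferFun (f : C(G.InfPath, ℂ)) : Continuous (G.transferFun f) := by
  have hF : ∀ e : G.E, Continuous fun c : G.InfPath =>
      if h : G.s e = G.range c then f (G.cons e c h) else 0 := by
    intro e
    have hU : IsOpen {c : G.InfPath | G.s e = G.range c} :=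
      (isOpen_discrete {v : G.V | G.s e = v}).preimage G.continuous_range
    have hU' : IsOpen {c : G.InfPath | ¬ G.s e = G.range c} :=
      (isOpen_discrete {v : G.V | ¬ G.s e = v}).preimage G.continuous_range
    rw [← continuousOn_univ]
    have : (Set.univ : Set G.InfPath) =
        {c | G.s e = G.range c} ∪ {c | ¬ G.s e = G.range c} := by
      ext c; simpa using _root_.em _
    rw [this]
    refine ContinuousOn.union_of_isOpen ?_ ?_ hU hU'
    · rw [continuousOn_iff_continuous_domRestrict]
      have : Continuous fun c : {c : G.InfPath | G.s e = G.range c} =>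
          f (G.cons e c.1 c.2) := by
        refine f.continuous.comp (Continuous.subtype_mk (continuous_pi fun i => ?_) _)
        cases i with
        | zero => exact continuous_const
        | succ n =>
          exact (continuous_apply n).comp (continuous_subtype_val.comp continuous_subtype_val)
      refine this.congr fun c => ?_
      have hc : G.s e = G.range c.1 := c.2
      simp [hc]
    · refine (continuousOn_const (c := (0 : ℂ))).congr fun c hc => ?_
      have hc' : ¬ G.s e = G.range c := hc
      rw [dif_neg hc']
  have h : G.transferFun f = fun c => (Fintype.card (G.Out (G.range c)) : ℂ)⁻¹ *
      ∑ e : G.E, if h : G.s e = G.range c then f (G.cons e c h) else 0 := by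
    ext c
    rw [transferFun]
    congr 1
    rw [← Finset.sum_filter_add_sum_filter_not Finset.univ (fun e => G.s e = G.range c),
      Finset.sum_eq_zero (s := Finset.univ.filter fun e => ¬ G.s e = G.range c), add_zero]
    · refine Finset.sum_bij (fun e _ => e.1) (fun e _ => by simpa using e.2)
        (fun a _ b _ hab => Subtype.ext hab)
        (fun e he => ⟨⟨e, by simpa using he⟩, Finset.mem_univ _, rfl⟩) fun e _ => ?_
      rw [dif_pos e.2]
    · intro e he
      rw [dif_neg (by simpa using he)]
  rw [h]
  refine Continuous.mul ?_ (continuous_finsetSum _ fun e _ => hF e)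
  exact (continuous_of_discreteTopology
    (f := fun v : G.V => (Fintype.card (G.Out v) : ℂ)⁻¹)).comp G.continuous_range

/-- The system `(C(E^∞), α, L)` associated to the backward shift, where `α(f) = f ∘ σ`. -/
def transfer : TransferOperator G.InfPath where
  α := ContinuousMap.compStarAlgHom' ℂ ℂ G.shift
  L :=
    { toFun := fun f => ⟨G.transferFun f, G.continuous_transferFun f⟩
      map_add' := fun f g => by
        ext c
        simp [transferFun, Finset.sum_add_distrib, mul_add]
      map_smul' := fun z f => by
        ext c
        simp [transferFun, ← Finset.mul_sum, mul_left_comm] }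
  nonneg f hf c := by
    refine mul_nonneg (inv_nonneg.2 (Nat.cast_nonneg _)) (Finset.sum_nonneg fun e _ => ?_)
    exact hf _
  apply_mul f g := by
    ext c
    have h : ∀ e : G.Out (G.range c), G.shift (G.cons e.1 c e.2) = c :=
      fun e => Subtype.ext (funext fun i => rfl)
    simp [transferFun, h, ← Finset.sum_mul, mul_assoc]

/-- The characteristic function of the cylinder set `Z(e) = {c | c₀ = e}`. -/
def cylinder (e : G.E) : C(G.InfPath, ℂ) :=
  ContinuousMap.comp ⟨Set.indicator {e} 1, continuous_of_discreteTopology⟩ (G.edge 0)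

/-- The function `m = ∑ₑ w(e) χ_{Z(e)}`. -/
def filterFun (w : G.E → ℂ) : C(G.InfPath, ℂ) := ∑ e, w e • G.cylinder e

/-- The projection of `E^(-∞,∞)` onto `E^[-k,∞)`, which is identified with `E^∞` by renumbering the
edges: `⋯c₋₁c₀c₁⋯` is sent to `c₋ₖc₋ₖ₊₁⋯`. For `k = 0` this is the projection onto `E^∞`. -/
def proj (k : ℕ) : C(G.BiPath, G.InfPath) where
  toFun d := ⟨fun i : ℕ => d.1 (i - k), fun i => by
    have h : (i : ℤ) - k + 1 = ((i + 1 : ℕ) : ℤ) - k := by push_cast; ring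
    rw [d.2 (i - k), h]⟩
  continuous_toFun := Continuous.subtype_mk
    (continuous_pi fun i : ℕ => G.continuous_biEdge (i - k)) _

/-- The backward shift `h` on `E^(-∞,∞)`. -/
def biShift : G.BiPath ≃ₜ G.BiPath where
  toFun d := ⟨fun i : ℤ => d.1 (i + 1), fun i => d.2 (i + 1)⟩
  invFun d := ⟨fun i : ℤ => d.1 (i - 1), fun i => by
    have h : i - 1 + 1 = i + 1 - 1 := by ring
    rw [d.2 (i - 1), h]⟩
  left_inv d := Subtype.ext <| funext fun i => by simp
  right_inv d := Subtype.ext <| funext fun i => by simp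
  continuous_toFun := Continuous.subtype_mk
    (continuous_pi fun i : ℤ => G.continuous_biEdge (i + 1)) _
  continuous_invFun := Continuous.subtype_mk
    (continuous_pi fun i : ℤ => G.continuous_biEdge (i - 1)) _

/-! ### The measures on the fibres of `E^(-∞,∞) → E^∞` -/

open MeasureTheory

/-- A choice, for each `n` and each vertex `v`, of an edge with source `v`. -/
def Choice : Type u := (p : ℕ × G.V) → G.Out p.2

instance : TopologicalSpace G.Choice :=
  inferInstanceAs (TopologicalSpace ((p : ℕ × G.V) → G.Out p.2))
instance : MeasurableSpace G.Choice :=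
  inferInstanceAs (MeasurableSpace ((p : ℕ × G.V) → G.Out p.2))
instance (v : G.V) : BorelSpace (G.Out v) := ⟨borel_eq_top_of_discrete.symm⟩
instance : OpensMeasurableSpace G.Choice :=
  inferInstanceAs (OpensMeasurableSpace ((p : ℕ × G.V) → G.Out p.2))

/-- The measure on `s⁻¹(v)` which gives an edge `e` the mass `|w(e)|² |s⁻¹(v)|⁻¹`. -/
def edgeMeasure (w : G.E → ℂ) (v : G.V) : Measure (G.Out v) :=
  ∑ e : G.Out v, ENNReal.ofReal (‖w e.1‖ ^ 2 / Fintype.card (G.Out v)) • Measure.dirac e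

/-- The law of a family of independent random choices. -/
def choiceMeasure (w : G.E → ℂ) : Measure G.Choice :=
  Measure.infinitePi fun p : ℕ × G.V => G.edgeMeasure w p.2

instance (w : G.E → ℂ) : IsFiniteMeasure (G.choiceMeasure w) := by
  by_cases h : ∀ p : ℕ × G.V, IsProbabilityMeasure (G.edgeMeasure w p.2)
  · have : IsProbabilityMeasure (G.choiceMeasure w) :=
      inferInstanceAs (IsProbabilityMeasure (Measure.infinitePi _))
    infer_instance
  · have : G.choiceMeasure w = 0 := by
      rw [choiceMeasure, Measure.infinitePi, dif_neg h]
      rfl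
    rw [this]
    infer_instance

/-- The edges `c₋₁, c₋₂, …` preceding `c`, read off from a family of choices. -/
def past (ω : G.Choice) (c : G.InfPath) : ℕ → G.E
  | 0 => (ω (0, G.range c)).1
  | n + 1 => (ω (n + 1, G.r (past ω c n))).1

/-- The two-sided path extending `c` whose past is read off from a family of choices. -/
def extend (ω : G.Choice) (c : G.InfPath) : G.BiPath where
  val
    | Int.ofNat n => c.1 n
    | Int.negSucc n => G.past ω c n
  property i := by
    match i with
    | Int.ofNat n => exact c.2 n
    | Int.negSucc 0 => exact (ω (0, G.range c)).2
    | Int.negSucc (n + 1) => exact (ω (n + 1, G.r (G.past ω c n))).2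

lemma proj_extend (ω : G.Choice) (c : G.InfPath) : G.proj 0 (G.extend ω c) = c := by
  refine Subtype.ext (funext fun i => ?_)
  change (G.extend ω c).1 ((i : ℤ) - (0 : ℕ)) = c.1 i
  rw [Nat.cast_zero, sub_zero]
  rfl

lemma continuous_choice (n : ℕ) :
    Continuous fun p : G.Choice × G.V => (p.1 (n, p.2)).1 := by
  rw [continuous_prod_of_discrete_right]
  intro v
  exact (continuous_of_discreteTopology (f := fun e : G.Out v => e.1)).comp
    (continuous_apply ((n, v) : ℕ × G.V))

lemma continuous_past (n : ℕ) :
    Continuous fun p : G.Choice × G.InfPath => G.past p.1 p.2 n := by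
  induction n with
  | zero =>
    exact (G.continuous_choice 0).comp
      (continuous_fst.prodMk (G.continuous_range.comp continuous_snd))
  | succ n ih =>
    exact (G.continuous_choice (n + 1)).comp
      (continuous_fst.prodMk ((continuous_of_discreteTopology (f := G.r)).comp ih))

lemma continuous_extend :
    Continuous fun p : G.Choice × G.InfPath => G.extend p.1 p.2 := by
  refine Continuous.subtype_mk (continuous_pi fun i => ?_) _
  match i with
  | Int.ofNat n => exact (continuous_apply n).comp (continuous_subtype_val.comp continuous_snd)
  | Int.negSucc n => exact G.continuous_past n

lemma continuous_extend_left (c : G.InfPath) : Continuous fun ω => G.extend ω c :=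
  G.continuous_extend.comp (continuous_id.prodMk continuous_const)

/-- The measure `μ^c` on two-sided paths, carried by the fibre over `c ∈ E^∞`: the past of `c` is
chosen at random, an edge `e` with the prescribed source having probability `|w(e)|² |s⁻¹(s(e))|⁻¹`. -/
def pathMeasure (w : G.E → ℂ) (c : G.InfPath) : Measure G.BiPath :=
  (G.choiceMeasure w).map fun ω => G.extend ω c

instance (w : G.E → ℂ) (c : G.InfPath) : IsFiniteMeasure (G.pathMeasure w c) := by
  unfold pathMeasure; infer_instance

/-- `μ` is the probability measure on two-sided paths which is carried by the fibre `π₀⁻¹(c)` and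
satisfies `∫ x ∘ πₖ dμ = ∑_{d} x(d) |wₖ(d)|²` for all `k` and all continuous functions `x` on
`E^[-k,∞)`, where `d` runs over the extensions of `c` in `E^[-k,∞)`. With `E^[-k,∞)` identified with
`E^∞`, these are the `d` with `σᵏ(d) = c`, and `|wₖ(d)|² = ∏_{j < k} |w(dⱼ)|² |s⁻¹(s(dⱼ))|⁻¹`. -/
structure IsFibreMeasure (w : G.E → ℂ) (c : G.InfPath) (μ : Measure G.BiPath) : Prop where
  isProbabilityMeasure : IsProbabilityMeasure μ
  ae_fibre : ∀ᵐ d ∂μ, G.proj 0 d = c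
  integral_proj : ∀ (k : ℕ) (x : C(G.InfPath, ℂ)),
    ∫ d, x (G.proj k d) ∂μ = ∑ᶠ (d : G.InfPath) (_ : G.shift^[k] d = c),
      x d * ((∏ j ∈ Finset.range k,
        ‖w (d.1 j)‖ ^ 2 / Fintype.card (G.Out (G.s (d.1 j))) : ℝ) : ℂ)

lemma integral_pathMeasure (w : G.E → ℂ) (c : G.InfPath) (x : C(G.BiPath, ℂ)) :
    ∫ d, x d ∂G.pathMeasure w c = ∫ ω, x (G.extend ω c) ∂G.choiceMeasure w :=
  integral_map (G.continuous_extend_left c).measurable.aemeasurable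
    x.continuous.aestronglyMeasurable

lemma integrable_pathMeasure (w : G.E → ℂ) (c : G.InfPath) (x : C(G.BiPath, ℂ)) :
    Integrable (fun d => x d) (G.pathMeasure w c) :=
  Integrable.of_bound x.continuous.aestronglyMeasurable ‖x‖
    (Filter.Eventually.of_forall fun d => x.norm_coe_le_norm d)

lemma continuous_integral (w : G.E → ℂ) (x : C(G.BiPath, ℂ)) :
    Continuous fun c => ∫ d, x d ∂G.pathMeasure w c := by
  simp only [G.integral_pathMeasure]
  refine continuous_of_dominated (bound := fun _ => ‖x‖) (fun c => ?_) (fun c => ?_)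
    (integrable_const _) ?_
  · exact (x.continuous.comp (G.continuous_extend_left c)).aestronglyMeasurable
  · exact Filter.Eventually.of_forall fun ω => x.norm_coe_le_norm _
  · exact Filter.Eventually.of_forall fun ω =>
      x.continuous.comp (G.continuous_extend.comp (continuous_const.prodMk continuous_id))

/-- The function `c ↦ ∫ x dμ^c`. -/
def fibreIntegral (w : G.E → ℂ) (x : C(G.BiPath, ℂ)) : C(G.InfPath, ℂ) :=
  ⟨fun c => ∫ d, x d ∂G.pathMeasure w c, G.continuous_integral w x⟩

/-- `C(E^(-∞,∞))` with `(x · f)(d) = x(d) f(π₀(d))` and `⟨x, y⟩(c) = ∫ conj(x) y dμ^c`. -/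
def preBilateral (w : G.E → ℂ) : PreHilbMod G.InfPath where
  carrier := C(G.BiPath, ℂ)
  module := Module.compHom _
    (ContinuousMap.compStarAlgHom' ℂ ℂ (G.proj 0) : C(G.InfPath, ℂ) →+* C(G.BiPath, ℂ))
  isScalarTower := by
    let := Module.compHom C(G.BiPath, ℂ)
      (ContinuousMap.compStarAlgHom' ℂ ℂ (G.proj 0) : C(G.InfPath, ℂ) →+* C(G.BiPath, ℂ))
    refine ⟨fun z f x => ?_⟩
    ext d
    change z * f (G.proj 0 d) * x d = z * (f (G.proj 0 d) * x d)
    rw [mul_assoc]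
  form x y := G.fibreIntegral w (star x * y)
  form_add x y z := by
    ext c
    simp only [fibreIntegral, ContinuousMap.coe_mk, ContinuousMap.add_apply, mul_add]
    exact integral_add (G.integrable_pathMeasure w c (star x * y))
      (G.integrable_pathMeasure w c (star x * z))
  form_smul f x y := by
    ext c
    change ∫ d, (star x * (f.comp (G.proj 0) * y)) d ∂G.pathMeasure w c =
      f c * ∫ d, (star x * y) d ∂G.pathMeasure w c
    rw [G.integral_pathMeasure, G.integral_pathMeasure, ← integral_const_mul]
    refine integral_congr_ae (Filter.Eventually.of_forall fun ω => ?_)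
    simp only [ContinuousMap.mul_apply, ContinuousMap.comp_apply, G.proj_extend]
    ring
  star_form x y := by
    ext c
    change star (∫ d, (star x * y) d ∂G.pathMeasure w c) = ∫ d, (star y * x) d ∂G.pathMeasure w c
    rw [RCLike.star_def, ← integral_conj]
    refine integral_congr_ae (Filter.Eventually.of_forall fun d => ?_)
    simp [mul_comm]
  form_self_nonneg x c := by
    change 0 ≤ ∫ d, (star x * x) d ∂G.pathMeasure w c
    have h : ∀ d, (star x * x) d = ((‖x d‖ ^ 2 : ℝ) : ℂ) := fun d => by
      simp [Complex.conj_mul']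
    simp only [h]
    rw [integral_complex_ofReal]
    exact Complex.zero_le_real.2 (integral_nonneg fun d => by positivity)

/-- The Hilbert module `X_∞(E)`, the completion of `C(E^(-∞,∞))`. -/
def bilateral (w : G.E → ℂ) : HilbMod G.InfPath := (G.preBilateral w).completion

/-- The image in `X_∞(E)` of a continuous function on `E^(-∞,∞)`. -/
def toBilateral (w : G.E → ℂ) (x : C(G.BiPath, ℂ)) : G.bilateral w :=
  (G.preBilateral w).toCompletion x

/-- `(Dx)(c) = m(π₀(c)) x(h(c))` for `x ∈ C(E^(-∞,∞))`. -/
def dilation (w : G.E → ℂ) (x : C(G.BiPath, ℂ)) : C(G.BiPath, ℂ) :=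
  (G.filterFun w).comp (G.proj 0) * x.comp (G.biShift : C(G.BiPath, G.BiPath))

end FinDigraph

end

/-! Write `A` for the coefficient algebra. All assertions follow from four properties of the
dilation, collected in `IsDilation`: `D(x · f) = D(x) · α(f)`, `L⟨Dx, Dy⟩ = ⟨x, y⟩`, `Dφ = φ · m`
for a unit vector `φ`, and density of the vectors that some power of `D` sends into `φ · A`. The
second property at `x = y = φ` says that `m` is a filter. It also makes `x ↦ Dx ⊗ 1` isometric, and
its range is dense because `x ⊗ f = D(D⁻¹(x · f)) ⊗ 1`.

For the direct limit, the tensor powers must be made concrete. The transfer operator of the graph is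
bounded below on positive functions: `f(c)` is one of the non-negative terms in the average
`L(f)(σ(c))`, so `‖f‖ ≤ |E¹| ‖L f‖` (`isBoundedBelow_transfer`). Hence the norm coming from `⟨x, y⟩
= Lᵏ(x* y)` dominates the supremum norm up to a constant, and `M_L^{⊗ k}` is `C(K)` itself, with `m
⊗ n` corresponding to `m α(n)` (`powRealization`). In this picture `x ↦ D⁻ᵏ(φ · x)` is an isometric
embedding onto `D⁻ᵏ(φ · A)`, compatible with `T_k` because `D(φ · x) = φ · m α(x)`. These embeddings
glue to `Q` (`exists_lim_iso`). Orthogonal splittings come from the rank-one projection `x ↦ φ · ⟨φ,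
x⟩`, transported by powers of `D` (`isProjectiveMRA`).

For the graph, the source of the analytic facts is the recursion `integral_step`: a random past of
`c` is a random edge `e` followed by an independent random past of `ec`. Iterated, it yields the
formula for `∫ x ∘ πₖ dμ^c`; applied once to `conj(x) y`, it yields `L⟨Dx, Dy⟩ = ⟨x, y⟩`. With the
lower bound for `L`, this makes `D` and `D⁻¹` bounded. Density is Stone–Weierstrass for functions of
finitely many past edges: each application of `D` removes one past edge from such a function. -/

noncomputable section

/-! ### Hilbert modules: isometric extensions and internal tensor products -/

section HilbertModules

variable {K : Type u} [TopologicalSpace K] [CompactSpace K]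

namespace HilbMod

variable (X Y : HilbMod K)

lemma norm_smul_le' (f : C(K, ℂ)) (x : X) : ‖f • x‖ ≤ ‖f‖ * ‖x‖ := by
  refine le_of_sq_le_sq ?_ (by positivity)
  rw [mul_pow, CStarModule.norm_sq_eq C(K, ℂ) (x := f • x),
    CStarModule.norm_sq_eq C(K, ℂ) (x := x), CStarModule.inner_op_smul_left, CStarModule.inner_op_smul_right]
  calc ‖f * inner C(K, ℂ) x x * star f‖ ≤ ‖f‖ * ‖inner C(K, ℂ) x x‖ * ‖star f‖ :=
        (norm_mul_le _ _).trans (mul_le_mul_of_nonneg_right (norm_mul_le _ _) (norm_nonneg _))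
    _ = _ := by rw [norm_star]; ring

lemma continuous_const_smul' (f : C(K, ℂ)) : Continuous fun x : X => f • x :=
  ((LinearMap.lsmul C(K, ℂ) X.carrier f).toAddMonoidHom.mkNormedAddGroupHom ‖f‖
    (X.norm_smul_le' f)).continuous

lemma continuous_smul_const (x : X) : Continuous fun f : C(K, ℂ) => f • x :=
  ((LinearMap.toSpanSingleton C(K, ℂ) X.carrier x).toAddMonoidHom.mkNormedAddGroupHom ‖x‖
    (fun f => (X.norm_smul_le' f x).trans_eq (mul_comm _ _))).continuous

lemma continuous_inner' {S : Type*} [TopologicalSpace S] {f g : S → X} (hf : Continuous f)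
    (hg : Continuous g) : Continuous fun s => inner C(K, ℂ) (f s) (g s) :=
  CStarModule.continuous_inner.comp (hf.prodMk hg)

variable {X Y}

lemma norm_map_of_inner_map (ψ : X → Y)
    (h : ∀ x y, inner C(K, ℂ) (ψ x) (ψ y) = inner C(K, ℂ) x y) (x : X) : ‖ψ x‖ = ‖x‖ := by
  rw [CStarModule.norm_eq_sqrt_norm_inner_self (A := C(K, ℂ)), h,
    ← CStarModule.norm_eq_sqrt_norm_inner_self]

/-- An inner-product preserving module map is isometric. -/
def isometryOfInner (ψ : X.carrier →ₗ[C(K, ℂ)] Y.carrier)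
    (h : ∀ x y, inner C(K, ℂ) (ψ x) (ψ y) = inner C(K, ℂ) x y) : X.carrier →ₗᵢ[ℂ] Y.carrier where
  toLinearMap := ψ.restrictScalars ℂ
  norm_map' := norm_map_of_inner_map ψ h

/-- An inner-product preserving module map with dense range is an isomorphism. -/
lemma exists_iso_of_denseRange (ψ : X.carrier →ₗ[C(K, ℂ)] Y.carrier)
    (h : ∀ x y, inner C(K, ℂ) (ψ x) (ψ y) = inner C(K, ℂ) x y) (hd : DenseRange ψ) :
    ∃ I : X.Iso Y, ∀ x, I.toFun x = ψ x := by
  have hi : Isometry ψ := (isometryOfInner ψ h).isometry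
  have hs : Function.Surjective ψ := by
    -- As `X` is complete, an isometry out of it has closed range, so dense range means surjective.
    rw [← Set.range_eq_univ, ← hi.isClosedEmbedding.isClosed_range.closure_eq]
    exact hd.closure_range
  exact ⟨{ LinearEquiv.ofBijective ψ ⟨hi.injective, hs⟩ with inner_map := h }, fun x => rfl⟩

end HilbMod

namespace PreHilbMod

variable (P : PreHilbMod K)

lemma inner_toCompletion (x y : P.carrier) :
    inner C(K, ℂ) (P.toCompletion x) (P.toCompletion y) = P.form x y :=
  P.completion_inner_coe x y

lemma denseRange_toCompletion : DenseRange P.toCompletion :=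
  Completion.denseRange_coe

lemma norm_toCompletion (x : P.carrier) : ‖P.toCompletion x‖ = √‖P.form x x‖ := by
  rw [CStarModule.norm_eq_sqrt_norm_inner_self (A := C(K, ℂ)), P.inner_toCompletion]

variable {P}

/-- The extension to the completion of a bounded linear map. -/
def extension {Z : Type*} [NormedAddCommGroup Z] [NormedSpace ℂ Z] [CompleteSpace Z]
    (φ : P.carrier →ₗ[ℂ] Z) : P.completion.carrier →L[ℂ] Z :=
  φ.extendOfNorm (P.toCompletion.restrictScalars ℂ)

/-- `extension` is defined for every linear map; it is this bound that makes it agree with `φ` on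
the dense image of `P`. -/
lemma extension_apply {Z : Type*} [NormedAddCommGroup Z] [NormedSpace ℂ Z] [CompleteSpace Z]
    (φ : P.carrier →ₗ[ℂ] Z) {C : ℝ} (h : ∀ x, ‖φ x‖ ≤ C * √‖P.form x x‖) (x : P.carrier) :
    extension φ (P.toCompletion x) = φ x :=
  LinearMap.extendOfNorm_eq (e := P.toCompletion.restrictScalars ℂ) P.denseRange_toCompletion
    ⟨C, fun x => (h x).trans_eq (by rw [← P.norm_toCompletion]; rfl)⟩ x

/-- Preserving the form gives the bound with constant 1; linearity over `C(K, ℂ)` and the inner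
product identity then pass to the completion by density. -/
lemma exists_extension_of_inner {Y : HilbMod K} (φ : P.carrier →ₗ[C(K, ℂ)] Y.carrier)
    (h : ∀ x y, inner C(K, ℂ) (φ x) (φ y) = P.form x y) :
    ∃ ψ : P.completion.carrier →ₗ[C(K, ℂ)] Y.carrier, (∀ x, ψ (P.toCompletion x) = φ x) ∧
      ∀ x y, inner C(K, ℂ) (ψ x) (ψ y) = inner C(K, ℂ) x y := by
  have hb : ∀ x, ‖φ.restrictScalars ℂ x‖ ≤ 1 * √‖P.form x x‖ := fun x => by
    rw [one_mul, LinearMap.restrictScalars_apply,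
      CStarModule.norm_eq_sqrt_norm_inner_self (A := C(K, ℂ)), h]
  have ha := extension_apply (φ.restrictScalars ℂ) hb
  have hc : Continuous (extension (φ.restrictScalars ℂ)) :=
    (extension (φ.restrictScalars ℂ)).continuous
  refine ⟨{ toFun := extension (φ.restrictScalars ℂ)
            map_add' := map_add _
            map_smul' := fun f x => ?_ }, ha, fun x y => ?_⟩
  · refine P.denseRange_toCompletion.induction_on x (isClosed_eq ?_ ?_) fun a => ?_
    · exact hc.comp (P.completion.continuous_const_smul' f)
    · exact (Y.continuous_const_smul' f).comp hc
    · rw [← map_smul, ha, ha]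
      exact map_smul φ f a
  · refine P.denseRange_toCompletion.induction_on₂ (isClosed_eq ?_ ?_) (fun a b => ?_) x y
    · exact Y.continuous_inner' (hc.comp continuous_fst) (hc.comp continuous_snd)
    · exact P.completion.continuous_inner' continuous_fst continuous_snd
    · rw [P.inner_toCompletion]
      change inner C(K, ℂ) (extension (φ.restrictScalars ℂ) _)
        (extension (φ.restrictScalars ℂ) _) = _
      rw [ha, ha]
      exact h a b

end PreHilbMod

namespace Corr

variable (M : Corr K)

/-- A correspondence is in particular a `PreCorr` with its own inner product as form, so the
estimate `PreCorr.norm_left_le`, obtained by writing `‖f‖² - f* f` as a square, applies to it. -/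
lemma norm_left_le (f : C(K, ℂ)) (x : M.carrier) : ‖M.left f x‖ ≤ ‖f‖ * ‖x‖ := by
  let P : PreCorr K :=
    { carrier := M.carrier
      form := fun x y => inner C(K, ℂ) x y
      form_add := fun _ _ _ => CStarModule.inner_add_right
      form_smul := fun _ _ _ => CStarModule.inner_op_smul_right
      star_form := fun _ _ => CStarModule.star_inner _ _
      form_self_nonneg := fun _ => CStarModule.inner_self_nonneg
      left := M.left
      form_left := M.inner_left }
  have h := P.norm_left_le f x
  rw [P.toPreHilbMod.norm_def, P.toPreHilbMod.norm_def] at h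
  rwa [CStarModule.norm_eq_sqrt_norm_inner_self (A := C(K, ℂ)) (x := M.left f x),
    CStarModule.norm_eq_sqrt_norm_inner_self (A := C(K, ℂ)) (x := x)]

lemma continuous_left (f : C(K, ℂ)) : Continuous (M.left f) :=
  ((M.left f).toAddMonoidHom.mkNormedAddGroupHom ‖f‖ (M.norm_left_le f)).continuous

end Corr

namespace HilbMod

variable (X : HilbMod K) (M : Corr K)

lemma inner_tmul (x y : X) (m n : M.carrier) :
    inner C(K, ℂ) (X.tmul M x m) (X.tmul M y n) =
      inner C(K, ℂ) m (M.left (inner C(K, ℂ) x y) n) :=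
  PreHilbMod.inner_toCompletion _ _ _

lemma tmul_add (x : X) (m n : M.carrier) : X.tmul M x (m + n) = X.tmul M x m + X.tmul M x n :=
  (congrArg (X.preTensor M).toCompletion (TensorProduct.add_tmul m n x)).trans (map_add _ _ _)

lemma add_tmul (x y : X) (m : M.carrier) : X.tmul M (x + y) m = X.tmul M x m + X.tmul M y m :=
  (congrArg (X.preTensor M).toCompletion (TensorProduct.tmul_add m x y)).trans (map_add _ _ _)

lemma tmul_smul (f : C(K, ℂ)) (x : X) (m : M.carrier) :
    X.tmul M x (f • m) = f • X.tmul M x m :=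
  map_smul (X.preTensor M).toCompletion f (m ⊗ₜ[ℂ] x)

/-- The algebraic tensor product is taken over `ℂ`, so it is not balanced over `C(K, ℂ)`. Balancing
appears in the completion because the difference of the two sides has length zero. -/
lemma smul_tmul (f : C(K, ℂ)) (x : X) (m : M.carrier) :
    X.tmul M (f • x) m = X.tmul M x (M.left f m) := by
  rw [← sub_eq_zero, ← CStarModule.inner_self (A := C(K, ℂ)), CStarModule.inner_sub_left,
    CStarModule.inner_sub_right, CStarModule.inner_sub_right]
  simp only [X.inner_tmul, CStarModule.inner_op_smul_right, CStarModule.inner_op_smul_left,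
    M.inner_left, ← Module.End.mul_apply, ← map_mul]
  simp only [mul_comm, sub_self]

lemma norm_tmul_le (x : X) (m : M.carrier) : ‖X.tmul M x m‖ ≤ ‖x‖ * ‖m‖ := by
  refine le_of_sq_le_sq ?_ (by positivity)
  rw [CStarModule.norm_sq_eq C(K, ℂ), X.inner_tmul]
  calc _ ≤ ‖m‖ * ‖M.left (inner C(K, ℂ) x x) m‖ := CStarModule.norm_inner_le _
    _ ≤ ‖m‖ * (‖inner C(K, ℂ) x x‖ * ‖m‖) := by gcongr; exact M.norm_left_le _ _
    _ = _ := by rw [← CStarModule.norm_sq_eq C(K, ℂ)]; ring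

lemma continuous_tmul (x : X) : Continuous (X.tmul M x) :=
  ((AddMonoidHom.mk' (X.tmul M x) (X.tmul_add M x)).mkNormedAddGroupHom ‖x‖
    (X.norm_tmul_le M x)).continuous

/-- A submodule whose closure contains all elementary tensors is dense. -/
lemma dense_of_tmul_mem_closure (W : Submodule C(K, ℂ) (X.tensor M).carrier)
    (hW : ∀ x m, X.tmul M x m ∈ closure (W : Set (X.tensor M).carrier)) :
    Dense (W : Set (X.tensor M).carrier) := by
  have hadd : ∀ a b : X.tensor M, a ∈ closure (W : Set (X.tensor M).carrier) →
      b ∈ closure (W : Set (X.tensor M).carrier) →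
      a + b ∈ closure (W : Set (X.tensor M).carrier) := fun a b ha hb =>
    map_mem_closure₂ continuous_add ha hb fun a ha b hb => W.add_mem ha hb
  have h : ∀ t : M.carrier ⊗[ℂ] X.carrier,
      (X.preTensor M).toCompletion t ∈ closure (W : Set (X.tensor M).carrier) := by
    intro t
    induction t with
    | zero =>
      have : (X.preTensor M).toCompletion 0 ∈ closure (W : Set (X.tensor M).carrier) := by
        rw [map_zero]; exact subset_closure W.zero_mem
      exact this
    | add s t hs ht =>
      exact (map_add (X.preTensor M).toCompletion s t).symm ▸ hadd _ _ hs ht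
    | tmul m x => exact hW x m
  intro t
  refine (X.preTensor M).denseRange_toCompletion.induction_on
    (p := fun t => t ∈ closure (W : Set (X.tensor M).carrier)) t isClosed_closure h

end HilbMod

end HilbertModules

/-! ### Realizing the tensor powers of Exel's correspondence on `C(K)` -/

section TensorPowers

variable {K : Type u} [TopologicalSpace K] [CompactSpace K]

namespace TransferOperator

variable (τ : TransferOperator K)

/-- The transfer operator `L` is bounded below on positive functions. -/
def IsBoundedBelow (C : ℝ) : Prop := 0 ≤ C ∧ ∀ f : C(K, ℂ), 0 ≤ f → ‖f‖ ≤ C * ‖τ.L f‖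

lemma iterate_nonneg (k : ℕ) (f : C(K, ℂ)) (hf : 0 ≤ f) : 0 ≤ τ.L^[k] f := by
  induction k with
  | zero => exact hf
  | succ k ih => rw [Function.iterate_succ_apply']; exact τ.nonneg _ ih

variable {τ} in
lemma IsBoundedBelow.norm_le_iterate {C : ℝ} (hC : τ.IsBoundedBelow C) (k : ℕ) (f : C(K, ℂ))
    (hf : 0 ≤ f) : ‖f‖ ≤ C ^ k * ‖τ.L^[k] f‖ := by
  induction k with
  | zero => simp
  | succ k ih =>
    rw [Function.iterate_succ_apply', pow_succ, mul_assoc]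
    exact ih.trans (mul_le_mul_of_nonneg_left (hC.2 _ (τ.iterate_nonneg k f hf))
      (pow_nonneg hC.1 k))

-- This is what identifies completions with `C(K, ℂ)`: the supremum norm is controlled by the norm
-- of the inner product `Lᵏ(x* y)`, so the identity map extends boundedly from the pre-Hilbert
-- module to its completion.
variable {τ} in
lemma IsBoundedBelow.norm_le_sqrt {C : ℝ} (hC : τ.IsBoundedBelow C) (k : ℕ) (f : C(K, ℂ)) :
    ‖f‖ ≤ √(C ^ k) * √‖τ.L^[k] (star f * f)‖ := by
  rw [← Real.sqrt_mul (pow_nonneg hC.1 k)]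
  refine Real.le_sqrt_of_sq_le ?_
  rw [sq, ← CStarRing.norm_star_mul_self]
  exact hC.norm_le_iterate k _ (star_mul_self_nonneg f)

/-- A realization of a correspondence as `C(K, ℂ)` with the right action `x · f = x αᵏ(f)`, the
inner product `⟨x, y⟩ = Lᵏ(x* y)` and the left action by multiplication. -/
structure Realization (k : ℕ) (N : Corr K) where
  toFun : N.carrier →L[ℂ] C(K, ℂ)
  inner_eq : ∀ x y, inner C(K, ℂ) x y = τ.L^[k] (star (toFun x) * toFun y)
  map_smul : ∀ (f : C(K, ℂ)) x, toFun (f • x) = τ.α^[k] f * toFun x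
  map_left : ∀ (f : C(K, ℂ)) x, toFun (N.left f x) = f * toFun x
  surjective : Function.Surjective toFun

lemma inner_toExel (f g : C(K, ℂ)) :
    inner C(K, ℂ) (τ.toExel f) (τ.toExel g) = τ.L (star f * g) :=
  PreHilbMod.inner_toCompletion _ _ _

lemma denseRange_toExel : DenseRange τ.toExel :=
  τ.preExel.toPreHilbMod.denseRange_toCompletion

lemma left_toExel (f g : C(K, ℂ)) : τ.exel.left f (τ.toExel g) = τ.toExel (f * g) :=
  τ.preExel.leftCompletion_coe f g

lemma smul_toExel (f g : C(K, ℂ)) : f • τ.toExel g = τ.toExel (τ.α f * g) :=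
  (map_smul τ.preExel.toPreHilbMod.toCompletion f (show τ.ExelSpace from g)).symm

/-- The identity of `C(K, ℂ)`, extended to Exel's correspondence. -/
def exelFun : τ.exel.carrier →L[ℂ] C(K, ℂ) :=
  PreHilbMod.extension (P := τ.preExel.toPreHilbMod) (LinearMap.id (M := C(K, ℂ)))

variable {τ}

lemma exelFun_toExel {C : ℝ} (hC : τ.IsBoundedBelow C) (f : C(K, ℂ)) : τ.exelFun (τ.toExel f) = f :=
  PreHilbMod.extension_apply (P := τ.preExel.toPreHilbMod) (LinearMap.id (M := C(K, ℂ)))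
    (C := √(C ^ 1)) (hC.norm_le_sqrt 1) f

/-- The realization of the trivial correspondence. -/
def Realization.self : τ.Realization 0 (Corr.self K) where
  toFun := ContinuousLinearMap.id ℂ C(K, ℂ)
  inner_eq _ _ := mul_comm _ _
  map_smul _ _ := rfl
  map_left _ _ := rfl
  surjective := Function.surjective_id

/-- The map `(m ⊗ n) ↦ m α(n)` on the algebraic tensor product. -/
def tensorFun {N : Corr K} (Φ : N.carrier →L[ℂ] C(K, ℂ)) :
    N.carrier ⊗[ℂ] τ.exel.carrier →ₗ[ℂ] C(K, ℂ) :=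
  TensorProduct.lift <| LinearMap.mk₂ ℂ (fun n m => τ.exelFun m * τ.α (Φ n))
    (fun n n' m => by simp [mul_add]) (fun z n m => by simp)
    (fun n m m' => by simp [add_mul]) (fun z n m => by simp)

lemma tensorFun_tmul {N : Corr K} (Φ : N.carrier →L[ℂ] C(K, ℂ)) (n : N.carrier)
    (m : τ.exel.carrier) : tensorFun Φ (n ⊗ₜ m) = τ.exelFun m * τ.α (Φ n) := rfl

-- Positivity makes `L` bounded: `L f = ⟨1, f · 1⟩` in Exel's semi-inner product, and Cauchy–Schwarz
-- together with the bound for left multiplication gives `‖L f‖ ≤ ‖L 1‖ ‖f‖`.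
variable (τ) in
lemma continuous_L : Continuous τ.L := by
  refine (τ.L.toAddMonoidHom.mkNormedAddGroupHom ‖τ.L 1‖ fun f => ?_).continuous
  let P := τ.preExel.toPreHilbMod
  have h1 := P.norm_form_le (1 : C(K, ℂ)) (f * 1 : C(K, ℂ))
  have h2 : ‖(show P.carrier from (f * 1 : C(K, ℂ)))‖ ≤
      ‖f‖ * ‖(show P.carrier from (1 : C(K, ℂ)))‖ := τ.preExel.norm_left_le f (1 : C(K, ℂ))
  have h3 : ‖(show P.carrier from (1 : C(K, ℂ)))‖ ^ 2 = ‖τ.L 1‖ := by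
    refine (P.norm_sq (1 : C(K, ℂ))).trans ?_
    change ‖τ.L (star 1 * 1)‖ = _
    rw [star_one, one_mul]
  have h4 : P.form (1 : C(K, ℂ)) (f * 1 : C(K, ℂ)) = τ.L f := by
    change τ.L (star 1 * (f * 1)) = _
    rw [star_one, one_mul, mul_one]
  rw [h4] at h1
  calc ‖τ.L f‖ ≤ _ := h1
    _ ≤ ‖(show P.carrier from (1 : C(K, ℂ)))‖ *
        (‖f‖ * ‖(show P.carrier from (1 : C(K, ℂ)))‖) :=
      mul_le_mul_of_nonneg_left h2 (Real.sqrt_nonneg _)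
    _ = ‖τ.L 1‖ * ‖f‖ := by rw [← h3]; ring

/-- Exel's correspondence is realized on `C(K, ℂ)`. -/
def exelRealization {C : ℝ} (hC : τ.IsBoundedBelow C) : τ.Realization 1 τ.exel where
  toFun := τ.exelFun
  inner_eq x y := by
    refine τ.denseRange_toExel.induction_on₂ (isClosed_eq ?_ ?_) (fun a b => ?_) x y
    · exact τ.exel.continuous_inner' continuous_fst continuous_snd
    · exact τ.continuous_L.comp (((τ.exelFun.continuous.comp continuous_fst).star).mul
        (τ.exelFun.continuous.comp continuous_snd))
    · rw [exelFun_toExel hC, exelFun_toExel hC, τ.inner_toExel]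
      rfl
  map_smul f x := by
    refine τ.denseRange_toExel.induction_on x (isClosed_eq ?_ ?_) fun a => ?_
    · exact τ.exelFun.continuous.comp (τ.exel.continuous_const_smul' f)
    · exact continuous_const.mul τ.exelFun.continuous
    · rw [τ.smul_toExel, exelFun_toExel hC, exelFun_toExel hC]
      rfl
  map_left f x := by
    refine τ.denseRange_toExel.induction_on x (isClosed_eq ?_ ?_) fun a => ?_
    · exact τ.exelFun.continuous.comp (τ.exel.continuous_left f)
    · exact continuous_const.mul τ.exelFun.continuous
    · rw [τ.left_toExel, exelFun_toExel hC, exelFun_toExel hC]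
  surjective f := ⟨τ.toExel f, exelFun_toExel hC f⟩

/-- On elementary tensors, one application of `L` takes `α(n'* n)` out of `L(m'* m α(n'* n))` by the
transfer identity. What remains is `Lᵏ(n'* ⟨m', m⟩ n)`, the inner product of `n'` with `⟨m', m⟩ · n`
as realized on `C(K, ℂ)`. -/
lemma iterate_L_tensorFun {C : ℝ} (hC : τ.IsBoundedBelow C) {k : ℕ} {N : Corr K}
    (R : τ.Realization k N) (s t : N.carrier ⊗[ℂ] τ.exel.carrier) :
    τ.L^[k + 1] (star (tensorFun R.toFun s) * tensorFun R.toFun t) =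
      τ.exel.toHilbMod.tensorForm N s t := by
  have hadd : ∀ f g, τ.L^[k + 1] (f + g) = τ.L^[k + 1] f + τ.L^[k + 1] g :=
    iterate_map_add τ.L (k + 1)
  have hzero : τ.L^[k + 1] 0 = 0 := iterate_map_zero τ.L (k + 1)
  induction t with
  | zero => rw [map_zero, mul_zero, hzero, map_zero]
  | add t t' ht ht' => rw [map_add, mul_add, hadd, ht, ht', map_add]
  | tmul n m =>
    induction s with
    | zero => rw [map_zero, star_zero, zero_mul, hzero, map_zero, LinearMap.zero_apply]
    | add s s' hs hs' =>
      rw [map_add, star_add, add_mul, hadd, hs, hs', map_add, LinearMap.add_apply]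
    | tmul n' m' =>
      rw [HilbMod.tensorForm_tmul, R.inner_eq, R.map_left, (exelRealization hC).inner_eq,
        tensorFun_tmul, tensorFun_tmul, Function.iterate_succ_apply]
      have h : star (τ.exelFun m' * τ.α (R.toFun n')) * (τ.exelFun m * τ.α (R.toFun n)) =
          star (τ.exelFun m') * τ.exelFun m * τ.α (star (R.toFun n') * R.toFun n) := by
        rw [map_mul τ.α, map_star τ.α, star_mul]
        ring
      rw [h, τ.apply_mul]
      exact congrArg τ.L^[k] (mul_left_comm _ _ _)

lemma norm_tensorFun_le {C : ℝ} (hC : τ.IsBoundedBelow C) {k : ℕ} {N : Corr K}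
    (R : τ.Realization k N) (t : N.carrier ⊗[ℂ] τ.exel.carrier) :
    ‖tensorFun R.toFun t‖ ≤ √(C ^ (k + 1)) * √‖τ.exel.toHilbMod.tensorForm N t t‖ := by
  rw [← iterate_L_tensorFun hC R]
  exact hC.norm_le_sqrt (k + 1) _

/-- The map `m ⊗ n ↦ m α(n)` on the internal tensor product. -/
def tensorExtension {N : Corr K} (Φ : N.carrier →L[ℂ] C(K, ℂ)) :
    (τ.exel.toHilbMod.tensor N).carrier →L[ℂ] C(K, ℂ) :=
  PreHilbMod.extension (P := τ.exel.toHilbMod.preTensor N) (tensorFun Φ)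

lemma tensorExtension_toCompletion {C : ℝ} (hC : τ.IsBoundedBelow C) {k : ℕ} {N : Corr K}
    (R : τ.Realization k N) (t : N.carrier ⊗[ℂ] τ.exel.carrier) :
    tensorExtension R.toFun ((τ.exel.toHilbMod.preTensor N).toCompletion t) =
      tensorFun R.toFun t :=
  PreHilbMod.extension_apply (P := τ.exel.toHilbMod.preTensor N) (tensorFun R.toFun)
    (norm_tensorFun_le hC R) t

lemma tensorExtension_tmul {C : ℝ} (hC : τ.IsBoundedBelow C) {k : ℕ} {N : Corr K}
    (R : τ.Realization k N) (m : τ.exel.carrier) (n : N.carrier) :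
    tensorExtension R.toFun (τ.exel.toHilbMod.tmul N m n) = τ.exelFun m * τ.α (R.toFun n) :=
  tensorExtension_toCompletion hC R (n ⊗ₜ m)

lemma inner_eq_tensorExtension {C : ℝ} (hC : τ.IsBoundedBelow C) {k : ℕ} {N : Corr K}
    (R : τ.Realization k N) (x y : τ.exel.toHilbMod.tensor N) :
    inner C(K, ℂ) x y =
      τ.L^[k + 1] (star (tensorExtension R.toFun x) * tensorExtension R.toFun y) := by
  have hc := (tensorExtension (τ := τ) R.toFun).continuous
  have hL : Continuous τ.L^[k + 1] := τ.continuous_L.iterate (k + 1)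
  refine (τ.exel.toHilbMod.preTensor N).denseRange_toCompletion.induction_on₂
    (isClosed_eq ?_ ?_) (fun a b => ?_) x y
  · exact (τ.exel.toHilbMod.tensor N).continuous_inner' continuous_fst continuous_snd
  · exact hL.comp ((hc.comp continuous_fst).star.mul (hc.comp continuous_snd))
  · have ha := tensorExtension_toCompletion hC R a
    have hb := tensorExtension_toCompletion hC R b
    refine (PreHilbMod.inner_toCompletion _ a b).trans ((iterate_L_tensorFun hC R a b).symm.trans ?_)
    exact congrArg τ.L^[k + 1] (congrArg₂ (fun u v => star u * v) ha.symm hb.symm)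

lemma tensorExtension_smul {C : ℝ} (hC : τ.IsBoundedBelow C) {k : ℕ} {N : Corr K}
    (R : τ.Realization k N) (f : C(K, ℂ)) (x : τ.exel.toHilbMod.tensor N) :
    tensorExtension R.toFun (f • x) = τ.α^[k + 1] f * tensorExtension R.toFun x := by
  have hc := (tensorExtension (τ := τ) R.toFun).continuous
  refine (τ.exel.toHilbMod.preTensor N).denseRange_toCompletion.induction_on x
    (isClosed_eq ?_ ?_) fun a => ?_
  · exact hc.comp ((τ.exel.toHilbMod.tensor N).continuous_const_smul' f)
  · exact continuous_const.mul hc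
  · have h : ∀ a : N.carrier ⊗[ℂ] τ.exel.carrier,
        tensorFun R.toFun (f • a) = τ.α^[k + 1] f * tensorFun R.toFun a := by
      intro a
      induction a with
      | zero => simp
      | add s t hs ht => rw [smul_add, map_add, map_add, hs, ht, mul_add]
      | tmul n m =>
        rw [TensorProduct.smul_tmul', tensorFun_tmul, tensorFun_tmul, R.map_smul, map_mul,
          Function.iterate_succ_apply', mul_left_comm]
    have h' := (tensorExtension_toCompletion hC R (f • a)).trans (h a)
    refine Eq.trans (congrArg _ ?_) (h'.trans
      (congrArg (τ.α^[k + 1] f * ·) (tensorExtension_toCompletion hC R a).symm))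
    exact (map_smul (τ.exel.toHilbMod.preTensor N).toCompletion f _).symm

lemma tensorExtension_left {C : ℝ} (hC : τ.IsBoundedBelow C) {k : ℕ} {N : Corr K}
    (R : τ.Realization k N) (f : C(K, ℂ)) (x : (τ.exel.tensor N).carrier) :
    tensorExtension R.toFun ((τ.exel.tensor N).left f x) = f * tensorExtension R.toFun x := by
  have hc := (tensorExtension (τ := τ) R.toFun).continuous
  refine (τ.exel.toHilbMod.preTensor N).denseRange_toCompletion.induction_on (p := fun x =>
    tensorExtension R.toFun ((τ.exel.tensor N).left f x) = f * tensorExtension R.toFun x) x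
    (isClosed_eq ?_ ?_) fun a => ?_
  · exact hc.comp ((τ.exel.tensor N).continuous_left f)
  · exact continuous_const.mul hc
  · have h : ∀ a : N.carrier ⊗[ℂ] τ.exel.carrier,
        tensorFun R.toFun (τ.exel.preTensorLeft N f a) = f * tensorFun R.toFun a := by
      intro a
      induction a with
      | zero => simp
      | add s t hs ht => rw [map_add, map_add, map_add, hs, ht, mul_add]
      | tmul n m =>
        rw [Corr.preTensorLeft_tmul, tensorFun_tmul, tensorFun_tmul, ← mul_assoc]
        exact congrArg (· * _) ((exelRealization hC).map_left f m)
    have h' := (tensorExtension_toCompletion hC R (τ.exel.preTensorLeft N f a)).trans (h a)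
    refine Eq.trans (congrArg _ ?_) (h'.trans
      (congrArg (f * ·) (tensorExtension_toCompletion hC R a).symm))
    exact (τ.exel.preTensor N).leftCompletion_coe f a

/-- A realization of `N` induces one of `M_L ⊗ N`. -/
def Realization.tensor {C : ℝ} (hC : τ.IsBoundedBelow C) {k : ℕ} {N : Corr K}
    (R : τ.Realization k N) : τ.Realization (k + 1) (τ.exel.tensor N) where
  toFun := tensorExtension R.toFun
  inner_eq := inner_eq_tensorExtension hC R
  map_smul := tensorExtension_smul hC R
  map_left := tensorExtension_left hC R
  surjective f := by
    -- With `n` realized by `1`, the tensor `f ⊗ n` is realized by `f α(1) = f`.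
    obtain ⟨n, hn⟩ := R.surjective 1
    refine ⟨τ.exel.toHilbMod.tmul N (τ.toExel f) n, ?_⟩
    refine (tensorExtension_tmul hC R _ _).trans ?_
    rw [hn, map_one, mul_one, exelFun_toExel hC]

/-- The realization of the tensor power `M_L^{⊗ k}`. -/
def powRealization {C : ℝ} (hC : τ.IsBoundedBelow C) : ∀ k, τ.Realization k (τ.exel.pow k)
  | 0 => Realization.self
  | k + 1 => (powRealization hC k).tensor hC

end TransferOperator

end TensorPowers

/-! ### Abstract dilations: scaling functions, direct limits and multi-resolution analyses -/

section Dilations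

variable {K : Type u} [TopologicalSpace K] [CompactSpace K]

lemma HilbSystem.form_mk (S : HilbSystem K) (k : ℕ) (x y : S.X k) :
    S.preLim.form (DirectLimit.Module.of C(K, ℂ) ℕ (fun k => (S.X k).carrier) S.map k x)
      (DirectLimit.Module.of C(K, ℂ) ℕ (fun k => (S.X k).carrier) S.map k y) =
        inner C(K, ℂ) x y := by
  unfold preLim
  exact DirectLimit.lift₂_def _ _ (fun k (x y : S.X k) => inner C(K, ℂ) x y)
    (fun i j h x y => (S.inner_map i j h x y).symm) k x y

namespace TransferOperator

variable (τ : TransferOperator K)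

/-- A dilation `D` of a Hilbert module `X` with a scaling vector `φ` for `m`, such that the vectors
which are mapped into `φ · C(K, ℂ)` by some power of `D` are dense. -/
structure IsDilation (m : C(K, ℂ)) (X : HilbMod K) (D : X.carrier ≃L[ℂ] X.carrier) (φ : X) :
    Prop where
  map_smul : ∀ (f : C(K, ℂ)) x, D (f • x) = τ.α f • D x
  L_inner : ∀ x y, τ.L (inner C(K, ℂ) (D x) (D y)) = inner C(K, ℂ) x y
  inner_self : inner C(K, ℂ) φ φ = 1
  map_scaling : D φ = m • φ
  dense : Dense {x | ∃ (k : ℕ) (f : C(K, ℂ)), D^[k] x = f • φ}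

namespace IsDilation

variable {τ} {m : C(K, ℂ)} {X : HilbMod K} {D : X.carrier ≃L[ℂ] X.carrier} {φ : X}

/-- Since `Dφ = φ · m` with `φ` a unit vector, the identity `L⟨Dφ, Dφ⟩ = ⟨φ, φ⟩` reads `L(m* m) =
1`. -/
lemma isFilter (h : τ.IsDilation m X D φ) : τ.exel.IsFilter (τ.toExel m) := by
  have := h.L_inner φ φ
  rw [h.map_scaling, h.inner_self, CStarModule.inner_op_smul_left,
    CStarModule.inner_op_smul_right, h.inner_self, mul_one] at this
  rw [Corr.IsFilter, τ.inner_toExel, mul_comm, this]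

lemma iterate_smul (h : τ.IsDilation m X D φ) (k : ℕ) (f : C(K, ℂ)) (x : X) :
    D^[k] (f • x) = τ.α^[k] f • D^[k] x := by
  induction k with
  | zero => rfl
  | succ k ih =>
    simp only [Function.iterate_succ_apply', ih, h.map_smul]

lemma iterate_inner (h : τ.IsDilation m X D φ) (k : ℕ) (x y : X) :
    τ.L^[k] (inner C(K, ℂ) (D^[k] x) (D^[k] y)) = inner C(K, ℂ) x y := by
  induction k with
  | zero => rfl
  | succ k ih =>
    rw [Function.iterate_succ_apply, Function.iterate_succ_apply' D,
      Function.iterate_succ_apply' D, h.L_inner, ih]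

/-- The map `x ↦ D x ⊗ 1`. -/
def tensorMap (h : τ.IsDilation m X D φ) :
    X.carrier →ₗ[C(K, ℂ)] (X.tensor τ.exel).carrier where
  toFun x := X.tmul τ.exel (D x) (τ.toExel 1)
  map_add' x y := by rw [map_add, X.add_tmul]
  map_smul' f x := by
    -- The twist by `α` disappears in the tensor product: `α(f)` moves across to multiply `1` on the
    -- left, which is the same as the right action of `f` on `1` in `M_L`.
    rw [h.map_smul, X.smul_tmul, τ.left_toExel, ← τ.smul_toExel, X.tmul_smul, RingHom.id_apply]

lemma inner_tensorMap (h : τ.IsDilation m X D φ) (x y : X) :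
    inner C(K, ℂ) (h.tensorMap x) (h.tensorMap y) = inner C(K, ℂ) x y := by
  refine (X.inner_tmul τ.exel _ _ _ _).trans ?_
  rw [τ.left_toExel, τ.inner_toExel, star_one, one_mul, mul_one, h.L_inner]

/-- By balancing, `x ⊗ f = (x · f) ⊗ 1`, and surjectivity of `D` puts this in the range; such
tensors suffice because `C(K, ℂ)` is dense in `M_L`. -/
lemma denseRange_tensorMap (h : τ.IsDilation m X D φ) : DenseRange h.tensorMap := by
  refine X.dense_of_tmul_mem_closure τ.exel (LinearMap.range h.tensorMap) fun x n => ?_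
  refine τ.denseRange_toExel.induction_on (p := fun n => X.tmul τ.exel x n ∈ closure _) n
    (isClosed_closure.preimage (X.continuous_tmul τ.exel x)) fun f => subset_closure ?_
  refine ⟨D.symm (f • x), ?_⟩
  change X.tmul τ.exel (D (D.symm (f • x))) (τ.toExel 1) = _
  rw [D.apply_symm_apply, X.smul_tmul, τ.left_toExel, mul_one]

lemma exists_scaling_iso (h : τ.IsDilation m X D φ) :
    ∃ D' : X.Iso (X.tensor τ.exel),
      (∀ x, D'.toFun x = X.tmul τ.exel (D x) (τ.toExel 1)) ∧
      IsScalingFunction τ.exel (τ.toExel m) X D' φ := by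
  obtain ⟨I, hI⟩ := HilbMod.exists_iso_of_denseRange h.tensorMap h.inner_tensorMap
    h.denseRange_tensorMap
  refine ⟨I, hI, h.inner_self, ?_⟩
  rw [hI]
  change X.tmul τ.exel (D φ) (τ.toExel 1) = _
  rw [h.map_scaling, X.smul_tmul, τ.left_toExel, mul_one]

lemma iterate_symm_apply (D : X.carrier ≃L[ℂ] X.carrier) (k : ℕ) (x : X) :
    D^[k] (D.symm^[k] x) = x :=
  Function.LeftInverse.iterate (f := D.symm) (g := D) D.apply_symm_apply k x

lemma iterate_injective (D : X.carrier ≃L[ℂ] X.carrier) (k : ℕ) : Function.Injective D^[k] :=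
  D.injective.iterate k

/-- The isometric embedding `x ↦ D⁻ᵏ(φ · Φ(x))` of a correspondence realized by `Φ`. -/
def embedding (h : τ.IsDilation m X D φ) {k : ℕ} {N : Corr K} (R : τ.Realization k N) :
    N.carrier →ₗ[C(K, ℂ)] X.carrier where
  toFun x := D.symm^[k] (R.toFun x • φ)
  map_add' x y := by
    rw [map_add, add_smul]
    exact iterate_map_add D.symm k _ _
  map_smul' f x := by
    -- The covariance is known for `D` rather than for its inverse, so both sides are compared after
    -- applying `Dᵏ`; each becomes `φ · αᵏ(f) Φ(x)`.
    refine iterate_injective D k ?_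
    rw [iterate_symm_apply, RingHom.id_apply, h.iterate_smul, iterate_symm_apply, R.map_smul,
      mul_smul]

lemma iterate_embedding (h : τ.IsDilation m X D φ) {k : ℕ} {N : Corr K} (R : τ.Realization k N)
    (x : N.carrier) : D^[k] (h.embedding R x) = R.toFun x • φ :=
  iterate_symm_apply D k _

/-- Applying `Dᵏ` inside and `Lᵏ` outside leaves an inner product in `X` unchanged; here it produces
`Lᵏ(Φ(x)* Φ(y))`, the realized inner product. -/
lemma inner_embedding (h : τ.IsDilation m X D φ) {k : ℕ} {N : Corr K} (R : τ.Realization k N)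
    (x y : N.carrier) :
    inner C(K, ℂ) (h.embedding R x) (h.embedding R y) = inner C(K, ℂ) x y := by
  rw [← h.iterate_inner k, h.iterate_embedding, h.iterate_embedding, R.inner_eq,
    CStarModule.inner_op_smul_left, CStarModule.inner_op_smul_right, h.inner_self, mul_one,
    mul_comm]

lemma mem_range_embedding (h : τ.IsDilation m X D φ) {k : ℕ} {N : Corr K}
    (R : τ.Realization k N) (x : X) :
    x ∈ LinearMap.range (h.embedding R) ↔ ∃ f : C(K, ℂ), D^[k] x = f • φ := by
  constructor
  · rintro ⟨n, rfl⟩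
    exact ⟨_, h.iterate_embedding R n⟩
  · rintro ⟨f, hf⟩
    obtain ⟨n, rfl⟩ := R.surjective f
    exact ⟨n, iterate_injective D k ((h.iterate_embedding R n).trans hf.symm)⟩

/-- Compatibility with the connecting map `T_k`: one further `D` turns `φ · Φ(n)` into `φ · m
α(Φ(n))`, and `m α(Φ(n))` is the realization of `m ⊗ n`. -/
lemma embedding_tmul (h : τ.IsDilation m X D φ) {C : ℝ} (hC : τ.IsBoundedBelow C) {k : ℕ}
    {N : Corr K} (R : τ.Realization k N) (n : N.carrier) :
    h.embedding (R.tensor hC) (τ.exel.tmulLeft N (τ.toExel m) n) = h.embedding R n := by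
  refine iterate_injective D (k + 1) ((h.iterate_embedding (R.tensor hC) _).trans ?_)
  rw [Function.iterate_succ_apply', h.iterate_embedding, h.map_smul, h.map_scaling, ← mul_smul]
  have : (R.tensor hC).toFun (τ.exel.tmulLeft N (τ.toExel m) n) = τ.α (R.toFun n) * m := by
    refine (tensorExtension_tmul hC R (τ.toExel m) n).trans ?_
    rw [exelFun_toExel hC, mul_comm]
  exact congrArg (· • φ) this

/-- The embedding of the algebraic direct limit of the tensor powers. -/
def limEmbedding (h : τ.IsDilation m X D φ) {C : ℝ} (hC : τ.IsBoundedBelow C) :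
    (τ.exel.filterSystem (τ.toExel m) h.isFilter).preLim.carrier →ₗ[C(K, ℂ)] X.carrier :=
  DirectLimit.Module.lift C(K, ℂ) ℕ
    (fun k => ((τ.exel.filterSystem (τ.toExel m) h.isFilter).X k).carrier)
    (τ.exel.filterSystem (τ.toExel m) h.isFilter).map
    (fun k => h.embedding (powRealization hC k)) (fun i j hij x => by
      induction j, hij using Nat.le_induction with
      | base => rw [HilbSystem.map_self]
      | succ n hn ih =>
        rw [HilbSystem.map_succ _ i n hn, ← ih]
        exact h.embedding_tmul hC (powRealization hC n) _)

/-- Any two elements of the algebraic limit come from a common level, where the embedding is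
isometric. The range is dense because it contains every vector that some `Dᵏ` sends into `φ · C(K,
ℂ)`. -/
lemma exists_lim_iso (h : τ.IsDilation m X D φ) {C : ℝ} (hC : τ.IsBoundedBelow C) :
    ∃ Q : (τ.exel.filterSystem (τ.toExel m) h.isFilter).lim.Iso X,
      ∀ k x, Q.toFun ((τ.exel.filterSystem (τ.toExel m) h.isFilter).ι k x) =
        h.embedding (powRealization hC k) x := by
  obtain ⟨ψ, hψ, hi⟩ := PreHilbMod.exists_extension_of_inner (h.limEmbedding hC)
    (DirectLimit.induction₂ _ fun k x y =>
      (h.inner_embedding (powRealization hC k) x y).trans (HilbSystem.form_mk _ k x y).symm)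
  obtain ⟨Q, hQ⟩ := HilbMod.exists_iso_of_denseRange ψ hi (by
    refine h.dense.mono ?_
    rintro x ⟨k, hx⟩
    obtain ⟨n, rfl⟩ := (h.mem_range_embedding (powRealization hC k) x).2 hx
    exact ⟨_, hψ (DirectLimit.Module.of C(K, ℂ) ℕ _ _ k n)⟩)
  exact ⟨Q, fun k x => (hQ _).trans (hψ _)⟩

lemma exists_projection (h : τ.IsDilation m X D φ) (x : X) :
    ∃ n, (∀ f : C(K, ℂ), inner C(K, ℂ) (f • φ) n = 0) ∧ x = inner C(K, ℂ) φ x • φ + n := by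
  refine ⟨x - inner C(K, ℂ) φ x • φ, fun f => ?_, (add_sub_cancel _ _).symm⟩
  rw [CStarModule.inner_op_smul_left, CStarModule.inner_sub_right,
    CStarModule.inner_op_smul_right, h.inner_self, mul_one, sub_self, zero_mul]

/-- The multiples of the unit vector `φ` are the fixed points of the continuous projection `x ↦ φ ·
⟨φ, x⟩`. -/
lemma isClosed_multiples (h : τ.IsDilation m X D φ) :
    IsClosed {x | ∃ f : C(K, ℂ), x = f • φ} := by
  have : {x | ∃ f : C(K, ℂ), x = f • φ} = {x | x = inner C(K, ℂ) φ x • φ} := by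
    ext x
    refine ⟨?_, fun hx => ⟨_, hx⟩⟩
    rintro ⟨f, rfl⟩
    rw [Set.mem_ofPred_eq, CStarModule.inner_op_smul_right, h.inner_self, mul_one]
  rw [this]
  exact isClosed_eq continuous_id
    ((X.continuous_smul_const φ).comp (X.continuous_inner' continuous_const continuous_id))

/-- Every level is the pullback of level zero along `Dᵏ`, and so is its complement: if `Dᵏ v` and
`Dᵏ n` are orthogonal, then `⟨v, n⟩ = Lᵏ⟨Dᵏ v, Dᵏ n⟩` vanishes. -/
lemma isProjectiveMRA (h : τ.IsDilation m X D φ) (V : ℕ → Submodule C(K, ℂ) X.carrier)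
    (hV : ∀ k x, x ∈ V k ↔ ∃ f : C(K, ℂ), D^[k] x = f • φ) : IsProjectiveMRA X D V := by
  have hclosed : ∀ k, IsClosed (V k : Set X.carrier) := fun k => by
    have : (V k : Set X.carrier) = D^[k] ⁻¹' {x | ∃ f : C(K, ℂ), x = f • φ} :=
      Set.ext fun x => hV k x
    rw [this]
    exact h.isClosed_multiples.preimage (D.continuous.iterate k)
  have hle : ∀ k, V k ≤ V (k + 1) := fun k x hx => by
    obtain ⟨f, hf⟩ := (hV k x).1 hx
    -- The coefficient comes from `D(φ · f) = (φ · m) · α(f)`.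
    refine (hV (k + 1) x).2 ⟨τ.α f * m, ?_⟩
    rw [Function.iterate_succ_apply', hf, h.map_smul, h.map_scaling, mul_smul]
  have hcompl : ∀ k x, ∃ y ∈ V k, ∃ n, (∀ v ∈ V k, inner C(K, ℂ) v n = 0) ∧ x = y + n := by
    intro k x
    obtain ⟨n, hn, hx⟩ := h.exists_projection (D^[k] x)
    refine ⟨D.symm^[k] (inner C(K, ℂ) φ (D^[k] x) • φ),
      (hV k _).2 ⟨_, iterate_symm_apply D k _⟩, D.symm^[k] n, fun v hv => ?_, ?_⟩
    · obtain ⟨f, hf⟩ := (hV k v).1 hv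
      rw [← h.iterate_inner k, iterate_symm_apply, hf, hn, iterate_map_zero]
    · refine iterate_injective D k ?_
      rw [iterate_map_add, iterate_symm_apply, iterate_symm_apply]
      exact hx
  refine ⟨⟨le_top, hclosed 0, fun x _ => ?_⟩, fun k => ?_, fun k => ⟨hle k, hclosed k,
    fun x hx => ?_⟩, ?_⟩
  · obtain ⟨y, hy, n, hn, hx⟩ := hcompl 0 x
    exact ⟨y, hy, n, trivial, hn, hx⟩
  · ext x
    exact (hV k x).trans (hV 0 _).symm
  · obtain ⟨y, hy, n, hn, rfl⟩ := hcompl k x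
    -- The orthogonal part stays in `V (k + 1)`, being the difference of two of its elements.
    exact ⟨y, hy, n, ((V (k + 1)).add_mem_iff_right (hle k hy)).1 hx, hn, rfl⟩
  · refine h.dense.mono ?_
    rintro x ⟨k, hx⟩
    exact Set.mem_iUnion.2 ⟨k, (hV k x).2 hx⟩

lemma exists_projectiveMRA (h : τ.IsDilation m X D φ) {C : ℝ} (hC : τ.IsBoundedBelow C) :
    ∃ Q : (τ.exel.filterSystem (τ.toExel m) h.isFilter).lim.Iso X,
      IsProjectiveMRA X D fun k =>
        (LinearMap.range ((τ.exel.filterSystem (τ.toExel m) h.isFilter).ι k)).map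
          Q.toLinearEquiv.toLinearMap := by
  obtain ⟨Q, hQ⟩ := h.exists_lim_iso hC
  refine ⟨Q, h.isProjectiveMRA _ fun k x => ?_⟩
  rw [← h.mem_range_embedding (powRealization hC k)]
  constructor
  · rintro ⟨_, ⟨n, rfl⟩, rfl⟩
    exact ⟨n, (hQ k n).symm⟩
  · rintro ⟨n, rfl⟩
    exact ⟨_, ⟨n, rfl⟩, hQ k n⟩

end IsDilation

end TransferOperator

end Dilations

/-! ### The graph: path spaces, fibre measures and the dilation on functions -/

open MeasureTheory

namespace FinDigraph

variable (G : FinDigraph.{u})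

instance : T2Space G.InfPath :=
  inferInstanceAs (T2Space {c : ℕ → G.E // ∀ i, G.s (c i) = G.r (c (i + 1))})

/-! ### Shifts and projections -/

lemma shift_cons (e : G.E) (c : G.InfPath) (h : G.s e = G.range c) :
    G.shift (G.cons e c h) = c :=
  Subtype.ext (funext fun _ => rfl)

lemma s_apply_zero (c : G.InfPath) : G.s (c.1 0) = G.range (G.shift c) := c.2 0

lemma cons_shift (c : G.InfPath) : G.cons (c.1 0) (G.shift c) (G.s_apply_zero c) = c :=
  Subtype.ext <| funext fun i => by cases i <;> rfl

lemma shift_eq_iff (d c : G.InfPath) :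
    G.shift d = c ↔ ∃ e : G.Out (G.range c), d = G.cons e.1 c e.2 := by
  constructor
  · rintro rfl
    exact ⟨⟨d.1 0, G.s_apply_zero d⟩, (G.cons_shift d).symm⟩
  · rintro ⟨e, rfl⟩
    exact G.shift_cons _ _ _

lemma iterate_shift_apply (k i : ℕ) (d : G.InfPath) : (G.shift^[k] d).1 i = d.1 (i + k) := by
  induction k generalizing d with
  | zero => rfl
  | succ k ih =>
    rw [Function.iterate_succ_apply, ih]
    exact congrArg d.1 (by ring)

lemma proj_apply (k i : ℕ) (d : G.BiPath) : (G.proj k d).1 i = d.1 (i - k) := rfl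

lemma proj_succ_biShift (k : ℕ) (d : G.BiPath) : G.proj (k + 1) (G.biShift d) = G.proj k d := by
  refine Subtype.ext (funext fun i => ?_)
  exact congrArg d.1 (show (i : ℤ) - (k + 1 : ℕ) + 1 = i - k by push_cast; ring)

lemma shift_proj_succ (k : ℕ) (d : G.BiPath) : G.shift (G.proj (k + 1) d) = G.proj k d := by
  refine Subtype.ext (funext fun i => ?_)
  exact congrArg d.1 (show ((i + 1 : ℕ) : ℤ) - (k + 1 : ℕ) = i - k by push_cast; ring)

lemma proj_zero_biShift (d : G.BiPath) : G.proj 0 (G.biShift d) = G.shift (G.proj 0 d) := by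
  rw [← G.shift_proj_succ, G.proj_succ_biShift]

lemma filterFun_apply (w : G.E → ℂ) (c : G.InfPath) : G.filterFun w c = w (c.1 0) := by
  classical
  have h : ∀ e, G.cylinder e c = if c.1 0 = e then 1 else 0 := fun e => by
    change Set.indicator {e} (1 : G.E → ℂ) (c.1 0) = _
    simp [Set.indicator_apply]
  simp [filterFun, ContinuousMap.sum_apply, h]

/-! ### The law of the past -/

variable {G} in
/-- The family of choices which starts with `η` and continues with `ω`. -/
def consChoice (q : ((v : G.V) → G.Out v) × G.Choice) : G.Choice
  | (0, v) => q.1 v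
  | (n + 1, v) => q.2 (n, v)

lemma measurable_consChoice : Measurable (consChoice (G := G)) := by
  refine measurable_pi_lambda _ fun p => ?_
  match p with
  | (0, v) => exact (measurable_pi_apply v).comp measurable_fst
  | (n + 1, v) => exact (measurable_pi_apply ((n, v) : ℕ × G.V)).comp measurable_snd

lemma past_consChoice (η : (v : G.V) → G.Out v) (ω : G.Choice) (c : G.InfPath) (n : ℕ) :
    G.past (consChoice (η, ω)) c (n + 1) =
      G.past ω (G.cons (η (G.range c)).1 c (η (G.range c)).2) n := by
  induction n with
  | zero => rfl
  | succ n ih => exact congrArg (fun e => (ω (n + 1, G.r e)).1) ih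

/-- Only the value of `η` at `r(c)` matters: it supplies the edge `c₋₁`. The remaining choices build
a past of `c₋₁c`, and the shift `h` restores the numbering. -/
lemma extend_consChoice (η : (v : G.V) → G.Out v) (ω : G.Choice) (c : G.InfPath) :
    G.extend (consChoice (η, ω)) c =
      G.biShift (G.extend ω (G.cons (η (G.range c)).1 c (η (G.range c)).2)) := by
  refine Subtype.ext (funext fun i => ?_)
  match i with
  | Int.ofNat n => rfl
  | Int.negSucc 0 => rfl
  | Int.negSucc (n + 1) => exact G.past_consChoice η ω c n

variable {G} in
/-- The weights `|w(e)|²` are normalized at every vertex. -/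
structure IsNormalized (w : G.E → ℂ) : Prop where
  out_nonempty : ∀ v, Nonempty (G.Out v)
  sum_eq : ∀ v, ∑ e : G.Out v, ‖w e.1‖ ^ 2 = Fintype.card (G.Out v)

variable {G} {w : G.E → ℂ}

namespace IsNormalized

lemma card_ne_zero (hw : IsNormalized w) (v : G.V) : (Fintype.card (G.Out v) : ℝ) ≠ 0 := by
  have := hw.out_nonempty v
  exact Nat.cast_ne_zero.2 Fintype.card_ne_zero

lemma isProbabilityMeasure_edgeMeasure (hw : IsNormalized w) (v : G.V) : IsProbabilityMeasure (G.edgeMeasure w v) := by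
  refine ⟨?_⟩
  simp only [edgeMeasure, Measure.finsetSum_apply, Measure.smul_apply, measure_univ, smul_eq_mul,
    mul_one]
  rw [← ENNReal.ofReal_sum_of_nonneg fun e _ => by positivity, ← Finset.sum_div, hw.sum_eq,
    div_self (hw.card_ne_zero v), ENNReal.ofReal_one]

lemma isProbabilityMeasure_choiceMeasure (hw : IsNormalized w) : IsProbabilityMeasure (G.choiceMeasure w) := by
  have := hw.isProbabilityMeasure_edgeMeasure
  exact inferInstanceAs (IsProbabilityMeasure (Measure.infinitePi _))

lemma isProbabilityMeasure_pathMeasure (hw : IsNormalized w) (c : G.InfPath) :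
    IsProbabilityMeasure (G.pathMeasure w c) := by
  have := hw.isProbabilityMeasure_choiceMeasure
  exact Measure.isProbabilityMeasure_map (G.continuous_extend_left c).measurable.aemeasurable

/-- The choices at time `0` are independent of the later ones, and the later ones have the same law
as the whole family. As a product measure is determined by its values on finite boxes, it is enough
to split a box along the two kinds of indices. -/
lemma map_consChoice (hw : IsNormalized w) :
    ((Measure.infinitePi fun v => G.edgeMeasure w v).prod (G.choiceMeasure w)).map consChoice =
      G.choiceMeasure w := by
  classical
  have hp := hw.isProbabilityMeasure_edgeMeasure
  refine Measure.eq_infinitePi (fun p : ℕ × G.V => G.edgeMeasure w p.2) fun s t ht => ?_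
  let f : G.V → ℕ × G.V := fun v => (0, v)
  let g : ℕ × G.V → ℕ × G.V := fun p => (p.1 + 1, p.2)
  have hf : Function.Injective f := fun a b h => (Prod.ext_iff.1 h).2
  have hg : Function.Injective g := fun a b h =>
    Prod.ext (Nat.succ_injective (Prod.ext_iff.1 h).1) (Prod.ext_iff.1 h).2
  have hpre : consChoice (G := G) ⁻¹' (Set.pi s t) =
      (Set.pi (s.preimage f hf.injOn) fun v => t (f v)) ×ˢ
        (Set.pi (s.preimage g hg.injOn) fun p => t (g p)) := by
    ext q
    constructor
    · exact fun h => ⟨fun v hv => h (0, v) (show f v ∈ s from Finset.mem_preimage.1 hv),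
        fun p hp => h (p.1 + 1, p.2) (show g p ∈ s from Finset.mem_preimage.1 hp)⟩
    · rintro ⟨h0, h1⟩ ⟨n, v⟩ hp
      cases n with
      | zero => exact h0 v (Finset.mem_preimage.2 hp)
      | succ n => exact h1 (n, v) (Finset.mem_preimage.2 hp)
  -- The two index maps have complementary ranges, so the products over the two preimages of `s`
  -- multiply to the product over `s`.
  have hrange : ∀ p, p ∈ Set.range g ↔ p ∉ Set.range f := by
    rintro ⟨_ | n, v⟩
    · refine ⟨?_, fun h => absurd ⟨v, rfl⟩ h⟩
      rintro ⟨p, hp⟩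
      exact absurd (congrArg Prod.fst hp) (Nat.succ_ne_zero _)
    · refine ⟨?_, fun _ => ⟨(n, v), rfl⟩⟩
      rintro _ ⟨v', hv⟩
      exact absurd (congrArg Prod.fst hv).symm (Nat.succ_ne_zero n)
  have hm : MeasurableSet (Set.pi (s : Set (ℕ × G.V)) t) :=
    MeasurableSet.pi s.countable_toSet fun p _ => ht p
  refine (Measure.map_apply G.measurable_consChoice hm).trans ?_
  have h0 := Measure.infinitePi_pi (fun v => G.edgeMeasure w v) (s := s.preimage f hf.injOn)
    (t := fun v => t (f v)) fun v _ => ht (f v)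
  have h1 := Measure.infinitePi_pi (fun p : ℕ × G.V => G.edgeMeasure w p.2)
    (s := s.preimage g hg.injOn) (t := fun p => t (g p)) fun p _ => ht (g p)
  refine (congrArg _ hpre).trans ((Measure.prod_prod _ _).trans
    ((congrArg₂ (· * ·) h0 h1).trans ?_))
  refine (congrArg₂ (· * ·)
    (Finset.prod_preimage' f s hf.injOn fun p => G.edgeMeasure w p.2 (t p))
    (Finset.prod_preimage' g s hg.injOn fun p => G.edgeMeasure w p.2 (t p))).trans ?_
  simp only [hrange]
  exact Finset.prod_filter_mul_prod_filter_not _ _ _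

lemma integral_edgeMeasure (v : G.V) (F : G.Out v → ℂ) :
    ∫ e, F e ∂G.edgeMeasure w v =
      ∑ e : G.Out v, ((‖w e.1‖ ^ 2 / Fintype.card (G.Out v) : ℝ) : ℂ) * F e := by
  rw [edgeMeasure, integral_finsetSum_measure fun e _ => Integrable.smul_measure
    (integrable_dirac (by simp)) ENNReal.ofReal_ne_top]
  refine Finset.sum_congr rfl fun e _ => ?_
  rw [integral_smul_measure, integral_dirac, ENNReal.toReal_ofReal (by positivity),
    Complex.real_smul]

/-- Conditioning on the edge `e = c₋₁`: Fubini separates the choices at time `0` from the rest, and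
the inner integral depends on the former only through the edge chosen at `r(c)`. -/
lemma integral_step (hw : IsNormalized w) (F : C(G.BiPath, ℂ)) (c : G.InfPath) :
    ∫ d, F d ∂G.pathMeasure w c = ∑ e : G.Out (G.range c),
      ((‖w e.1‖ ^ 2 / Fintype.card (G.Out (G.range c)) : ℝ) : ℂ) *
        ∫ d, F (G.biShift d) ∂G.pathMeasure w (G.cons e.1 c e.2) := by
  have hp := hw.isProbabilityMeasure_edgeMeasure
  have hc := hw.isProbabilityMeasure_choiceMeasure
  have hF : StronglyMeasurable fun ω : G.Choice => F (G.extend ω c) :=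
    (F.continuous.comp (G.continuous_extend_left c)).stronglyMeasurable
  have hint : Integrable (fun q => F (G.extend (consChoice q) c))
      ((Measure.infinitePi fun v => G.edgeMeasure w v).prod (G.choiceMeasure w)) :=
    Integrable.of_bound (hF.comp_measurable G.measurable_consChoice).aestronglyMeasurable ‖F‖
      (Filter.Eventually.of_forall fun q => F.norm_coe_le_norm _)
  rw [G.integral_pathMeasure]
  conv_lhs => rw [← hw.map_consChoice]
  rw [integral_map G.measurable_consChoice.aemeasurable hF.aestronglyMeasurable,
    integral_prod _ hint]
  simp only [G.extend_consChoice]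
  have hev := measurePreserving_eval_infinitePi (fun v => G.edgeMeasure w v) (G.range c)
  have h := integral_map (μ := Measure.infinitePi fun v => G.edgeMeasure w v)
    hev.measurable.aemeasurable
    (f := fun e : G.Out (G.range c) =>
      ∫ ω, F (G.biShift (G.extend ω (G.cons e.1 c e.2))) ∂G.choiceMeasure w)
    Measurable.of_discrete.aestronglyMeasurable
  rw [hev.map_eq, integral_edgeMeasure] at h
  refine h.symm.trans (Finset.sum_congr rfl fun e _ => ?_)
  congr 1
  exact (G.integral_pathMeasure w _ (F.comp (G.biShift : C(G.BiPath, G.BiPath)))).symm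

end IsNormalized

end FinDigraph

namespace FinDigraph

variable {G : FinDigraph.{u}} {w : G.E → ℂ}

/-! ### The measures `μ^c` -/

lemma setOf_iterate_shift_succ (k : ℕ) (c : G.InfPath) :
    {d : G.InfPath | G.shift^[k + 1] d = c} =
      ⋃ e : G.Out (G.range c), {d | G.shift^[k] d = G.cons e.1 c e.2} := by
  ext d
  rw [Set.mem_ofPred_eq, Function.iterate_succ_apply', G.shift_eq_iff, Set.mem_iUnion]
  rfl

lemma finite_iterate_shift (k : ℕ) (c : G.InfPath) :
    {d : G.InfPath | G.shift^[k] d = c}.Finite := by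
  induction k generalizing c with
  | zero => exact Set.finite_singleton c
  | succ k ih =>
    rw [setOf_iterate_shift_succ]
    exact Set.finite_iUnion fun e => ih _

/-- The paths `d` with `σᵏ⁺¹(d) = c` are sorted by the first edge `e` of `σᵏ(d)`, which makes the
pieces disjoint. Their finiteness matters, since a `finsum` of infinite support is zero by default.
-/
lemma finsum_iterate_shift_succ (k : ℕ) (c : G.InfPath) (f : G.InfPath → ℂ) :
    ∑ᶠ (d : G.InfPath) (_ : G.shift^[k + 1] d = c), f d =
      ∑ e : G.Out (G.range c), ∑ᶠ (d : G.InfPath) (_ : G.shift^[k] d = G.cons e.1 c e.2), f d := by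
  have h := finsum_mem_iUnion (f := f)
    (t := fun e : G.Out (G.range c) => {d | G.shift^[k] d = G.cons e.1 c e.2}) ?_
    (fun e => finite_iterate_shift k _)
  · rw [← setOf_iterate_shift_succ] at h
    exact h.trans (finsum_eq_sum_of_fintype _)
  · intro e e' hne
    refine Set.disjoint_left.2 fun d hd hd' => hne (Subtype.ext ?_)
    exact congrArg (fun c : G.InfPath => c.1 0)
      (Eq.trans (Eq.symm hd) hd' : G.cons e.1 c e.2 = G.cons e'.1 c e'.2)

lemma IsNormalized.integral_proj (hw : IsNormalized w) (c : G.InfPath) (k : ℕ)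
    (x : C(G.InfPath, ℂ)) :
    ∫ d, x (G.proj k d) ∂G.pathMeasure w c = ∑ᶠ (d : G.InfPath) (_ : G.shift^[k] d = c),
      x d * ((∏ j ∈ Finset.range k,
        ‖w (d.1 j)‖ ^ 2 / Fintype.card (G.Out (G.s (d.1 j))) : ℝ) : ℂ) := by
  induction k generalizing c with
  | zero =>
    have := hw.isProbabilityMeasure_choiceMeasure
    refine (G.integral_pathMeasure w c (x.comp (G.proj 0))).trans ?_
    simp [G.proj_extend]
  | succ k ih =>
    rw [finsum_iterate_shift_succ]
    refine (hw.integral_step (x.comp (G.proj (k + 1))) c).trans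
      (Finset.sum_congr rfl fun e _ => ?_)
    simp only [ContinuousMap.comp_apply, proj_succ_biShift]
    rw [ih, ← smul_eq_mul, smul_finsum]
    refine finsum_congr fun d => ?_
    rw [smul_finsum]
    refine finsum_congr fun hd => ?_
    -- Paths in `E^[-k-1,∞)` are renumbered from `0`, so the edge `e` in position `-1` has index
    -- `k`. The factor contributed by `integral_step` is therefore the last one in the product.
    have h0 : d.1 k = e.1 := by
      have := G.iterate_shift_apply k 0 d
      rw [hd, zero_add] at this
      exact this.symm
    rw [Finset.prod_range_succ, h0, e.2, smul_eq_mul]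
    push_cast
    ring

lemma IsNormalized.isFibreMeasure (hw : IsNormalized w) (c : G.InfPath) :
    G.IsFibreMeasure w c (G.pathMeasure w c) where
  isProbabilityMeasure := hw.isProbabilityMeasure_pathMeasure c
  ae_fibre := by
    have hm : MeasurableSet {d : G.BiPath | G.proj 0 d = c} :=
      (isClosed_singleton.preimage (G.proj 0).continuous).measurableSet
    exact (ae_map_iff (G.continuous_extend_left c).measurable.aemeasurable hm).2
      (Filter.Eventually.of_forall fun ω => G.proj_extend ω c)
  integral_proj := hw.integral_proj c

/-! ### The dilation -/

lemma transfer_L_apply (f : C(G.InfPath, ℂ)) (c : G.InfPath) :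
    G.transfer.L f c = (Fintype.card (G.Out (G.range c)) : ℂ)⁻¹ *
      ∑ e : G.Out (G.range c), f (G.cons e.1 c e.2) := rfl

/-- The path `c` is one of the preimages of `σ(c)` under the shift, and the sum over these preimages
has non-negative terms. Multiplying the average back by the number of terms costs at most `|E¹|`. -/
lemma isBoundedBelow_transfer : G.transfer.IsBoundedBelow (Fintype.card G.E) := by
  refine ⟨Nat.cast_nonneg _, fun f hf => ?_⟩
  refine (ContinuousMap.norm_le _ (by positivity)).2 fun c => ?_
  have hre : ∀ d, f d = (((f d).re : ℝ) : ℂ) ∧ 0 ≤ (f d).re := fun d => by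
    have := Complex.le_def.1 (hf d)
    exact ⟨Complex.ext rfl (by simpa using this.2.symm), this.1⟩
  let e0 : G.Out (G.range (G.shift c)) := ⟨c.1 0, G.s_apply_zero c⟩
  have : Nonempty (G.Out (G.range (G.shift c))) := ⟨e0⟩
  have hcard : (0 : ℝ) < Fintype.card (G.Out (G.range (G.shift c))) :=
    Nat.cast_pos.2 Fintype.card_pos
  have hle : (Fintype.card (G.Out (G.range (G.shift c))) : ℝ) ≤ Fintype.card G.E :=
    Nat.cast_le.2 (Fintype.card_le_of_injective (fun e => e.1) fun a b h => Subtype.ext h)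
  have hsum : (Fintype.card (G.Out (G.range (G.shift c))) : ℂ) * G.transfer.L f (G.shift c) =
      ((∑ e : G.Out (G.range (G.shift c)), (f (G.cons e.1 (G.shift c) e.2)).re : ℝ) : ℂ) := by
    rw [transfer_L_apply, mul_inv_cancel_left₀ (by exact_mod_cast hcard.ne')]
    push_cast
    exact Finset.sum_congr rfl fun e _ => (hre _).1
  have hn := congrArg norm hsum
  rw [norm_mul, Complex.norm_natCast, Complex.norm_real,
    Real.norm_of_nonneg (Finset.sum_nonneg fun e _ => (hre _).2)] at hn
  calc ‖f c‖ = (f c).re := by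
        rw [(hre c).1, Complex.norm_real, Real.norm_of_nonneg (hre c).2, Complex.ofReal_re]
    _ = (f (G.cons e0.1 (G.shift c) e0.2)).re := by rw [G.cons_shift c]
    _ ≤ ∑ e : G.Out (G.range (G.shift c)), (f (G.cons e.1 (G.shift c) e.2)).re :=
        Finset.single_le_sum (f := fun e : G.Out (G.range (G.shift c)) =>
          (f (G.cons e.1 (G.shift c) e.2)).re) (fun e _ => (hre _).2) (Finset.mem_univ e0)
    _ = _ := hn.symm
    _ ≤ _ := mul_le_mul hle ((G.transfer.L f).norm_coe_le_norm _) (norm_nonneg _)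
        (Nat.cast_nonneg _)

lemma form_apply (x y : C(G.BiPath, ℂ)) (c : G.InfPath) :
    (G.preBilateral w).form x y c = ∫ d, star (x d) * y d ∂G.pathMeasure w c := rfl

lemma dilation_apply (x : C(G.BiPath, ℂ)) (d : G.BiPath) :
    G.dilation w x d = w (d.1 0) * x (G.biShift d) := by
  change G.filterFun w (G.proj 0 d) * x (G.biShift d) = _
  rw [filterFun_apply]
  rfl

/-- This is `integral_step` for `conj(x) y`: the average in `L` provides the factors
`|s⁻¹(r(c))|⁻¹`, and the two copies of `m` in the dilations provide `|w(e)|²`. -/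
lemma IsNormalized.L_form_dilation (hw : IsNormalized w) (x y : C(G.BiPath, ℂ)) :
    G.transfer.L ((G.preBilateral w).form (G.dilation w x) (G.dilation w y)) =
      (G.preBilateral w).form x y := by
  ext c
  rw [transfer_L_apply, form_apply]
  refine Eq.trans ?_ (hw.integral_step (star x * y) c).symm
  rw [Finset.mul_sum]
  refine Finset.sum_congr rfl fun e _ => ?_
  have h : (G.preBilateral w).form (G.dilation w x) (G.dilation w y) (G.cons e.1 c e.2) =
      ((‖w e.1‖ ^ 2 : ℝ) : ℂ) *
        ∫ d, (star x * y) (G.biShift d) ∂G.pathMeasure w (G.cons e.1 c e.2) := by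
    rw [← integral_const_mul]
    refine integral_congr_ae ?_
    -- As the measure is carried by the fibre over `ec`, almost every `d` has `d₀ = e`, so the
    -- weight is constant and leaves the integral.
    filter_upwards [(hw.isFibreMeasure (G.cons e.1 c e.2)).ae_fibre] with d hd
    have hd0 : d.1 0 = e.1 := congrArg (fun c : G.InfPath => c.1 0) hd
    simp only [dilation_apply, hd0, star_mul', RCLike.star_def, ContinuousMap.mul_apply,
      ContinuousMap.star_apply]
    push_cast
    rw [← Complex.conj_mul']
    ring
  rw [h]
  push_cast
  ring

/-- The inverse of the dilation on continuous functions. -/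
def dilationInv (w : G.E → ℂ) (x : C(G.BiPath, ℂ)) : C(G.BiPath, ℂ) where
  -- The index `-1` appears because the edge of `h⁻¹(d)` in position `0` is `d₋₁`.
  toFun d := (w (d.1 (-1)))⁻¹ * x (G.biShift.symm d)
  continuous_toFun := ((continuous_of_discreteTopology (f := fun e => (w e)⁻¹)).comp
    (G.continuous_biEdge (-1))).mul (x.continuous.comp G.biShift.symm.continuous)

lemma dilation_dilationInv (hw0 : ∀ e, w e ≠ 0) (x : C(G.BiPath, ℂ)) :
    G.dilation w (dilationInv w x) = x := by
  ext d
  rw [dilation_apply]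
  change w (d.1 0) * ((w (d.1 0))⁻¹ * x (G.biShift.symm (G.biShift d))) = x d
  rw [G.biShift.symm_apply_apply, mul_inv_cancel_left₀ (hw0 _)]

lemma dilationInv_dilation (hw0 : ∀ e, w e ≠ 0) (x : C(G.BiPath, ℂ)) :
    dilationInv w (G.dilation w x) = x := by
  ext d
  change (w (d.1 (-1)))⁻¹ * G.dilation w x (G.biShift.symm d) = x d
  rw [dilation_apply]
  change (w (d.1 (-1)))⁻¹ * (w (d.1 (-1)) * x (G.biShift (G.biShift.symm d))) = x d
  rw [G.biShift.apply_symm_apply, inv_mul_cancel_left₀ (hw0 _)]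

end FinDigraph

/-- A bounded invertible operator extends to the completion. -/
lemma PreHilbMod.exists_completion_equiv {K : Type u} [TopologicalSpace K] [CompactSpace K]
    (P : PreHilbMod K) (S : P.carrier ≃ₗ[ℂ] P.carrier) {B C : ℝ}
    (hS : ∀ x, ‖P.form (S x) (S x)‖ ≤ B * ‖P.form x x‖)
    (hT : ∀ x, ‖P.form x x‖ ≤ C * ‖P.form (S x) (S x)‖) :
    ∃ D : P.completion.carrier ≃L[ℂ] P.completion.carrier,
      ∀ x, D (P.toCompletion x) = P.toCompletion (S x) := by
  have hb : ∀ (T : P.carrier →ₗ[ℂ] P.carrier) (A : ℝ),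
      (∀ x, ‖P.form (T x) (T x)‖ ≤ A * ‖P.form x x‖) → ∀ x,
        extension (P.toCompletion.restrictScalars ℂ ∘ₗ T) (P.toCompletion x) =
          P.toCompletion (T x) := by
    intro T A hA
    -- No sign is assumed for `A`; the absolute value allows the square root to be split.
    refine extension_apply (P.toCompletion.restrictScalars ℂ ∘ₗ T) (C := √|A|) fun x => ?_
    refine (P.norm_toCompletion (T x)).trans_le ?_
    rw [← Real.sqrt_mul (abs_nonneg A)]
    exact Real.sqrt_le_sqrt ((hA x).trans
      (mul_le_mul_of_nonneg_right (le_abs_self A) (norm_nonneg _)))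
  have h1 := hb S.toLinearMap B hS
  have h2 := hb S.symm.toLinearMap C fun x => by
    simpa only [LinearEquiv.coe_coe, LinearEquiv.apply_symm_apply] using hT (S.symm x)
  refine ⟨ContinuousLinearEquiv.equivOfInverse _
    (extension (P.toCompletion.restrictScalars ℂ ∘ₗ S.symm.toLinearMap)) (fun x => ?_)
    (fun x => ?_), h1⟩
  · refine P.denseRange_toCompletion.induction_on x (isClosed_eq ?_ continuous_id) fun a => ?_
    · exact (ContinuousLinearMap.continuous _).comp (ContinuousLinearMap.continuous _)
    · rw [h1, h2]
      exact congrArg _ (S.symm_apply_apply a)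
  · refine P.denseRange_toCompletion.induction_on x (isClosed_eq ?_ continuous_id) fun a => ?_
    · exact (ContinuousLinearMap.continuous _).comp (ContinuousLinearMap.continuous _)
    · rw [h2, h1]
      exact congrArg _ (S.apply_symm_apply a)

/-! ### The dilation on the completed module, and density of its multi-resolution levels -/

namespace FinDigraph

variable {G : FinDigraph.{u}} {w : G.E → ℂ}

/-- The dilation as a linear automorphism of `C(E^(-∞,∞))`. -/
def dilationEquiv (hw0 : ∀ e, w e ≠ 0) : C(G.BiPath, ℂ) ≃ₗ[ℂ] C(G.BiPath, ℂ) where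
  toFun := G.dilation w
  map_add' x y := by ext d; simp [dilation_apply, mul_add]
  map_smul' z x := by ext d; simp [dilation_apply, mul_left_comm]
  invFun := dilationInv w
  left_inv := dilationInv_dilation hw0
  right_inv := dilation_dilationInv hw0

/-- Both bounds come from `L⟨Dx, Dx⟩ = ⟨x, x⟩`: the lower bound for `L` on positive functions makes
`D` bounded, and the continuity of `L` makes its inverse bounded. -/
lemma IsNormalized.exists_dilation (hw : IsNormalized w) (hw0 : ∀ e, w e ≠ 0) :
    ∃ D : (G.bilateral w).carrier ≃L[ℂ] (G.bilateral w).carrier,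
      ∀ x, D (G.toBilateral w x) = G.toBilateral w (G.dilation w x) := by
  let Λ : C(G.InfPath, ℂ) →L[ℂ] C(G.InfPath, ℂ) := ⟨G.transfer.L, G.transfer.continuous_L⟩
  refine (G.preBilateral w).exists_completion_equiv (dilationEquiv hw0)
    (B := Fintype.card G.E) (C := ‖Λ‖) (fun x => ?_) fun x => ?_
  · refine (isBoundedBelow_transfer.2 _ ((G.preBilateral w).form_self_nonneg _)).trans_eq ?_
    exact congrArg (fun f => (Fintype.card G.E : ℝ) * ‖f‖) (hw.L_form_dilation x x)
  · refine le_trans (le_of_eq ?_) (Λ.le_opNorm _)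
    exact congrArg norm (hw.L_form_dilation x x).symm

lemma smul_toBilateral (f : C(G.InfPath, ℂ)) (x : C(G.BiPath, ℂ)) :
    f • G.toBilateral w x = G.toBilateral w (f.comp (G.proj 0) * x) :=
  (map_smul (G.preBilateral w).toCompletion f (show (G.preBilateral w).carrier from x)).symm

lemma denseRange_toBilateral : DenseRange (G.toBilateral w) :=
  (G.preBilateral w).denseRange_toCompletion

lemma inner_toBilateral (x y : C(G.BiPath, ℂ)) :
    inner C(G.InfPath, ℂ) (G.toBilateral w x) (G.toBilateral w y) =
      (G.preBilateral w).form x y :=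
  PreHilbMod.inner_toCompletion _ _ _

lemma IsNormalized.norm_toBilateral_le (hw : IsNormalized w) (x : C(G.BiPath, ℂ)) :
    ‖G.toBilateral w x‖ ≤ ‖x‖ := by
  refine le_of_sq_le_sq ?_ (norm_nonneg x)
  rw [CStarModule.norm_sq_eq C(G.InfPath, ℂ), inner_toBilateral]
  refine (ContinuousMap.norm_le _ (by positivity)).2 fun c => ?_
  have := hw.isProbabilityMeasure_pathMeasure c
  refine (norm_integral_le_of_norm_le_const (C := ‖x‖ ^ 2)
    (Filter.Eventually.of_forall fun d => ?_)).trans_eq (by simp)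
  have := x.norm_coe_le_norm d
  simp only [ContinuousMap.mul_apply, ContinuousMap.star_apply, norm_mul, norm_star, ← sq]
  gcongr

lemma IsNormalized.continuous_toBilateral (hw : IsNormalized w) : Continuous (G.toBilateral w) :=
  ((AddMonoidHom.mk' (G.toBilateral w)
    (map_add (G.preBilateral w).toCompletion)).mkNormedAddGroupHom 1
      fun x => (hw.norm_toBilateral_le x).trans_eq (one_mul _).symm).continuous

/-! ### Functions of finitely many past edges -/

/-- Since `σ ∘ πₖ₊₁ = πₖ`, composing with `σ` rewrites a function of `πₖ` as one of `πₖ₊₁`; any two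
cylinder functions thus share a level. -/
lemma exists_comp_proj_of_le (g : C(G.InfPath, ℂ)) {k l : ℕ} (h : k ≤ l) :
    ∃ g' : C(G.InfPath, ℂ), g.comp (G.proj k) = g'.comp (G.proj l) := by
  induction l, h using Nat.le_induction with
  | base => exact ⟨g, rfl⟩
  | succ n _ ih =>
    obtain ⟨g', hg'⟩ := ih
    refine ⟨g'.comp G.shift, ?_⟩
    rw [hg']
    ext d
    exact congrArg g' (G.shift_proj_succ n d).symm

lemma exists_comp_proj₂ (f g : C(G.InfPath, ℂ)) (k l : ℕ) :
    ∃ (n : ℕ) (f' g' : C(G.InfPath, ℂ)),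
      f.comp (G.proj k) = f'.comp (G.proj n) ∧ g.comp (G.proj l) = g'.comp (G.proj n) := by
  obtain ⟨f', hf⟩ := exists_comp_proj_of_le f (le_max_left k l)
  obtain ⟨g', hg⟩ := exists_comp_proj_of_le g (le_max_right k l)
  exact ⟨_, f', g', hf, hg⟩

variable (G) in
/-- The functions on `E^(-∞,∞)` which depend on only finitely many of the past edges. -/
def cylinderAlgebra : StarSubalgebra ℂ C(G.BiPath, ℂ) where
  carrier := {F | ∃ (k : ℕ) (g : C(G.InfPath, ℂ)), F = g.comp (G.proj k)}
  mul_mem' := by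
    rintro _ _ ⟨k, f, rfl⟩ ⟨l, g, rfl⟩
    obtain ⟨n, f', g', hf, hg⟩ := exists_comp_proj₂ f g k l
    exact ⟨n, f' * g', by rw [hf, hg]; rfl⟩
  add_mem' := by
    rintro _ _ ⟨k, f, rfl⟩ ⟨l, g, rfl⟩
    obtain ⟨n, f', g', hf, hg⟩ := exists_comp_proj₂ f g k l
    exact ⟨n, f' + g', by rw [hf, hg]; rfl⟩
  algebraMap_mem' z := ⟨0, algebraMap ℂ _ z, rfl⟩
  star_mem' := by
    rintro _ ⟨k, f, rfl⟩
    exact ⟨k, star f, rfl⟩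

lemma cylinder_apply_eq_one_iff (e : G.E) (c : G.InfPath) : G.cylinder e c = 1 ↔ c.1 0 = e := by
  classical
  change Set.indicator {e} (1 : G.E → ℂ) (c.1 0) = 1 ↔ _
  simp [Set.indicator_apply]

lemma separatesPoints_cylinderAlgebra :
    (cylinderAlgebra G).toSubalgebra.SeparatesPoints := by
  intro d d' hne
  have : ∃ i, d.1 i ≠ d'.1 i := by
    by_contra! h
    exact hne (Subtype.ext (funext h))
  obtain ⟨i, hi⟩ := this
  have hproj : ∃ (k n : ℕ), ∀ d : G.BiPath, (G.shift^[n] (G.proj k d)).1 0 = d.1 i := by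
    -- For `i ≥ 0` the edge is found by shifting `π₀(d)` forward `i` times; for `i < 0` it is the
    -- initial edge of the projection starting at `i`. Truncation to `ℕ` covers both cases.
    refine ⟨(-i).toNat, i.toNat, fun d => ?_⟩
    rw [iterate_shift_apply, proj_apply]
    exact congrArg d.1 (by omega)
  obtain ⟨k, n, hk⟩ := hproj
  let F : C(G.InfPath, ℂ) := (G.cylinder (d.1 i)).comp ⟨G.shift^[n], G.shift.continuous.iterate n⟩
  refine ⟨_, ⟨F.comp (G.proj k), ⟨k, F, rfl⟩, rfl⟩, fun h => hi ?_⟩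
  have h1 : F (G.proj k d) = 1 := (cylinder_apply_eq_one_iff _ _).2 (hk d)
  have h2 : F (G.proj k d') = 1 := h.symm.trans h1
  exact ((hk d').symm.trans ((cylinder_apply_eq_one_iff _ _).1 h2)).symm

/-- Stone–Weierstrass on the compact space of two-sided paths: two distinct paths are separated by a
single edge. -/
lemma dense_cylinderAlgebra : Dense (cylinderAlgebra G : Set C(G.BiPath, ℂ)) := by
  have h := ContinuousMap.starSubalgebra_topologicalClosure_eq_top_of_separatesPoints
    (cylinderAlgebra G) separatesPoints_cylinderAlgebra
  rw [dense_iff_closure_eq, ← StarSubalgebra.topologicalClosure_coe, h, StarSubalgebra.coe_top]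

lemma dilation_comp_mul (f g : C(G.InfPath, ℂ)) (k : ℕ) :
    G.dilation w (f.comp (G.proj 0) * g.comp (G.proj (k + 1))) =
      (G.filterFun w * f.comp G.shift).comp (G.proj 0) * g.comp (G.proj k) := by
  ext d
  change G.filterFun w (G.proj 0 d) * (f (G.proj 0 (G.biShift d)) *
    g (G.proj (k + 1) (G.biShift d))) = G.filterFun w (G.proj 0 d) * f (G.shift (G.proj 0 d)) *
      g (G.proj k d)
  rw [proj_zero_biShift, proj_succ_biShift, mul_assoc]

/-- Each application of `D` lowers `πₖ₊₁` to `πₖ` and contributes a factor depending on `π₀` alone.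
The function `f` accumulates these factors, and after `k` steps nothing but `π₀` is left. -/
lemma exists_iterate_dilation_eq {D : (G.bilateral w).carrier → (G.bilateral w).carrier}
    (hD : ∀ x, D (G.toBilateral w x) = G.toBilateral w (G.dilation w x)) (k : ℕ)
    (f g : C(G.InfPath, ℂ)) :
    ∃ f' : C(G.InfPath, ℂ),
      D^[k] (G.toBilateral w (f.comp (G.proj 0) * g.comp (G.proj k))) =
        f' • G.toBilateral w 1 := by
  induction k generalizing f with
  | zero =>
    refine ⟨f * g, ?_⟩
    rw [smul_toBilateral, mul_one]
    rfl
  | succ k ih =>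
    rw [Function.iterate_succ_apply, hD, dilation_comp_mul]
    exact ih _

lemma IsNormalized.isDilation (hw : IsNormalized w)
    {D : (G.bilateral w).carrier ≃L[ℂ] (G.bilateral w).carrier}
    (hD : ∀ x, D (G.toBilateral w x) = G.toBilateral w (G.dilation w x)) :
    G.transfer.IsDilation (G.filterFun w) (G.bilateral w) D (G.toBilateral w 1) where
  map_smul f x := by
    refine denseRange_toBilateral.induction_on x (isClosed_eq ?_ ?_) fun a => ?_
    · exact D.continuous.comp ((G.bilateral w).continuous_const_smul' f)
    · exact ((G.bilateral w).continuous_const_smul' _).comp D.continuous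
    · rw [smul_toBilateral, hD, hD, smul_toBilateral]
      congr 1
      ext d
      change _ * (f (G.proj 0 (G.biShift d)) * _) = f (G.shift (G.proj 0 d)) * (_ * _)
      rw [proj_zero_biShift, mul_left_comm]
      rfl
  L_inner x y := by
    refine denseRange_toBilateral.induction_on₂ (isClosed_eq ?_ ?_) (fun a b => ?_) x y
    · exact G.transfer.continuous_L.comp ((G.bilateral w).continuous_inner'
        (D.continuous.comp continuous_fst) (D.continuous.comp continuous_snd))
    · exact (G.bilateral w).continuous_inner' continuous_fst continuous_snd
    · rw [hD, hD, inner_toBilateral, inner_toBilateral, hw.L_form_dilation]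
  inner_self := by
    rw [inner_toBilateral]
    ext c
    have := hw.isProbabilityMeasure_pathMeasure c
    rw [form_apply]
    simp
  map_scaling := by
    rw [hD, smul_toBilateral]
    rfl
  dense := by
    refine (denseRange_toBilateral.dense_image hw.continuous_toBilateral
      dense_cylinderAlgebra).mono ?_
    rintro _ ⟨_, ⟨k, g, rfl⟩, rfl⟩
    -- The accumulated factor starts at `1`, so the vector is the given cylinder function `g ∘ πₖ`.
    obtain ⟨f', hf'⟩ := exists_iterate_dilation_eq hD k 1 g
    refine ⟨k, f', ?_⟩
    rw [← hf']
    congr 2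
    exact (one_mul _).symm

end FinDigraph

end

theorem mainTheorem10 (G : FinDigraph.{u}) (hsrc : G.NoSources) (hsnk : G.NoSinks)
    (w : G.E → ℂ) (hw0 : ∀ e, w e ≠ 0)
    (hw : ∀ v, ∑ e : G.Out v, ‖w e.1‖ ^ 2 = Fintype.card (G.Out v)) :
    (∀ c, G.IsFibreMeasure w c (G.pathMeasure w c)) ∧
    ∃ hm : G.transfer.exel.IsFilter (G.transfer.toExel (G.filterFun w)),
    ∃ D : G.bilateral w ≃L[ℂ] G.bilateral w,
      (∀ x, D (G.toBilateral w x) = G.toBilateral w (G.dilation w x)) ∧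
      (∃ D' : (G.bilateral w).Iso ((G.bilateral w).tensor G.transfer.exel),
        (∀ x, D'.toFun x = (G.bilateral w).tmul G.transfer.exel (D x) (G.transfer.toExel 1)) ∧
        IsScalingFunction G.transfer.exel (G.transfer.toExel (G.filterFun w)) (G.bilateral w) D'
          (G.toBilateral w 1)) ∧
      ∃ Q : (G.transfer.exel.filterSystem (G.transfer.toExel (G.filterFun w)) hm).lim.Iso
          (G.bilateral w),
        IsProjectiveMRA (G.bilateral w) D fun k =>
          (LinearMap.range ((G.transfer.exel.filterSystem
            (G.transfer.toExel (G.filterFun w)) hm).ι k)).map Q.toLinearEquiv.toLinearMap := by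
  have hn : FinDigraph.IsNormalized w :=
    ⟨fun v => let ⟨e, he⟩ := hsnk v; ⟨⟨e, he⟩⟩, hw⟩
  obtain ⟨D, hD⟩ := hn.exists_dilation hw0
  have h := hn.isDilation hD
  exact ⟨hn.isFibreMeasure, h.isFilter, D, hD, h.exists_scaling_iso,
    h.exists_projectiveMRA FinDigraph.isBoundedBelow_transfer⟩
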